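/- Let $\lambda$ be Lebesgue measure on $(0,1)$, let $H=L^2(\lambda;\mathbb{R})$, and let $e_n\in H$, $n\in\mathbb{Z}$, satisfy $e_0(x)=1$, $e_n(x)=\sqrt2\cos(2n\pi x)$ and $e_{-n}(x)=\sqrt2\sin(2n\pi x)$ for all $n\in\mathbb{N}=\{1,2,3,\dots\}$. Let $A\colon D(A)\subseteq H\to H$ be the Laplacian with periodic boundary conditions, i.e. $D(A)=\{v\in H\colon\sum_{n\in\mathbb{Z}}n^4|\langle e_n,v\rangle_H|^2<\infty\}$ and $Av=\sum_{n\in\mathbb{Z}}-4\pi^2n^2\langle e_n,v\rangle_He_n$ for $v\in D(A)$. Let $T,\eta\in(0,\infty)$ and let $(H_r,\|\cdot\|_{H_r},\langle\cdot,\cdot\rangle_{H_r})$, $r\in\mathbb{R}$, be the family of interpolation spaces associated to $\eta-A$: $H_r$ consists of the formal Fourier series $u=\sum_{n\in\mathbb{Z}}u_ne_n$ with $\|u\|_{H_r}^2=\sum_{n\in\mathbb{Z}}(\eta+4\pi^2n^2)^{2r}|u_n|^2<\infty$. Equivalently, $H_r=D((\eta-A)^r)$ with norm $\|(\eta-A)^rv\|_H$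 for $r\ge0$, and $H_r$ is the completion of $H$ with respect to $\|(\eta-A)^rv\|_H$ for $r\le0$. Let $P_N\in L(H_{-1},H_1)$, $N\in\mathbb{N}$, be the bounded linear operators with $P_Nv=\sum_{n=-N}^N\langle e_n,v\rangle_He_n$ for all $v\in H$. Let $(\Omega,\mathcal{F},\mathbb{P})$ be a probability space, let $q\in\{2,3,\dots\}$, $a_0,\dots,a_{q-1}\in\mathbb{R}$, $a_q\in\mathbb{R}\setminus\{0\}$, $\chi\in(1/4,\infty)$, $\nu\in(1/4,3/4)$, $\xi\in H_\chi$, and let $W\colon[0,T]\times\Omega\to H_{-\nu}$ be an $\mathrm{Id}_H$-cylindrical Wiener process, that is, $W_0=0$ almost surely, $W$ has almost surely continuous paths and independent increments, and for all $0\le s\le t\le T$ and $x\in H_{-\nu}$ the random variable $\langle x,W_t-W_s\rangle_{H_{-\nu}}$ is normally distributed with mean $0$ and variance $(t-s)\|J^*x\|_H^2$, where $J\colon H\to H_{-\nu}$ is the inclusion. Let $S_N\in L(H_{-\nu})$, $N\in\mathbb{N}$, be bounded linear operators which satisfy for all $N\in\mathbb{N}$, $r\in[-\nu,\infty)$ and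 $u,v\in H$ that $$S_N(H_r)\subseteq H_{r+1},\qquad \sup_{M\in\mathbb{N}}\ \sup_{s\in[0,1]}\ \sup_{w\in H,\,\|w\|_H\le1}M^{-s}\|S_Mw\|_{H_s}<\infty,\qquad S_Ne_0=e_0,$$ $$(\eta-A)^{-\nu}S_Nv=S_N(\eta-A)^{-\nu}v,\qquad \langle S_Nu,v\rangle_H=\langle u,S_Nv\rangle_H,\qquad P_NS_Nv=S_NP_Nv,$$ and let $Y^N\colon\{0,1,\dots,N\}\times\Omega\to H$, $N\in\mathbb{N}$, be stochastic processes which satisfy for all $N\in\mathbb{N}$, $n\in\{0,1,\dots,N-1\}$ that $Y^N_0=P_N\xi$ and $$Y^N_{n+1}=P_NS_N\Big(Y^N_n+\tfrac TN\Big(\sum_{k=0}^qa_k[Y^N_n]^k\Big)+\big(W_{(n+1)T/N}-W_{nT/N}\big)\Big).$$ Then for all $p\in(0,\infty)$ it holds that $\liminf_{N\to\infty}\mathbb{E}\big[\|Y^N_N\|_H^p\big]=\infty$. -/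

import Mathlib

open MeasureTheory ProbabilityTheory Set Filter
open scoped ENNReal NNReal Topology RealInnerProductSpace

noncomputable section

namespace SpectralSPDE

/-- Lebesgue measure on `(0,1)`. -/
abbrev unitMeasure : Measure ℝ := volume.restrict (Ioo (0 : ℝ) 1)

/-- The Hilbert space `H = L²((0,1); ℝ)` of equivalence classes of square integrable functions. -/
abbrev H : Type := Lp ℝ 2 unitMeasure

/-- The trigonometric functions `1`, `√2 cos(2nπx)` (`n > 0`), `√2 sin(2|n|πx)` (`n < 0`). -/
def trigFun (n : ℤ) (x : ℝ) : ℝ :=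
  if n = 0 then 1
  else if 0 < n then √2 * Real.cos (2 * n * Real.pi * x)
  else √2 * Real.sin (2 * (-n) * Real.pi * x)

theorem continuous_trigFun (n : ℤ) : Continuous (trigFun n) := by
  unfold trigFun
  split_ifs <;> fun_prop

theorem abs_trigFun_le (n : ℤ) (x : ℝ) : |trigFun n x| ≤ √2 := by
  have h1 : (1 : ℝ) ≤ √2 := by rw [Real.one_le_sqrt]; norm_num
  have h0 : (0 : ℝ) ≤ √2 := by positivity
  unfold trigFun
  split_ifs
  · simp [h1]
  · rw [abs_mul, abs_of_nonneg h0]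
    exact mul_le_of_le_one_right h0 (Real.abs_cos_le_one _)
  · rw [abs_mul, abs_of_nonneg h0]
    exact mul_le_of_le_one_right h0 (Real.abs_sin_le_one _)

theorem memLp_trigFun (n : ℤ) : MemLp (trigFun n) 2 unitMeasure :=
  MemLp.of_bound (continuous_trigFun n).aestronglyMeasurable (√2)
    (Eventually.of_forall fun x => abs_trigFun_le n x)

/-- The Fourier basis vector `e_n ∈ H`. -/
def e (n : ℤ) : H := (memLp_trigFun n).toLp (trigFun n)

theorem inner_e (n : ℤ) (v : H) : ⟪e n, v⟫ = ∫ x in (0 : ℝ)..1, trigFun n x * v x := by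
  rw [L2.inner_def, intervalIntegral.integral_of_le zero_le_one, integral_Ioc_eq_integral_Ioo]
  apply integral_congr_ae
  filter_upwards [(memLp_trigFun n).coeFn_toLp] with x hx
  simp only [e, hx]
  simp [mul_comm]

theorem integral_cos_int (k : ℤ) :
    ∫ x in (0 : ℝ)..1, Real.cos (2 * k * Real.pi * x) = if k = 0 then 1 else 0 := by
  split_ifs with hk
  · simp [hk]
  · have hk' : (k : ℝ) ≠ 0 := by exact_mod_cast hk
    have h : (2 * k * Real.pi : ℝ) ≠ 0 := by positivity
    rw [intervalIntegral.integral_comp_mul_left (fun x => Real.cos x) h, integral_cos]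
    have : Real.sin (2 * k * Real.pi) = 0 := by
      have := Real.sin_int_mul_pi (2 * k); push_cast at this; exact this
    simp [this]

theorem integral_sin_int (k : ℤ) : ∫ x in (0 : ℝ)..1, Real.sin (2 * k * Real.pi * x) = 0 := by
  by_cases hk : k = 0
  · simp [hk]
  · have hk' : (k : ℝ) ≠ 0 := by exact_mod_cast hk
    have h : (2 * k * Real.pi : ℝ) ≠ 0 := by positivity
    rw [intervalIntegral.integral_comp_mul_left (fun x => Real.sin x) h, integral_sin]
    have : Real.cos (2 * k * Real.pi) = 1 := by
      have := Real.cos_int_mul_two_pi k; rw [← this]; ring_nf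
    simp [this]

theorem integral_trigFun_mul (m n : ℤ) :
    ∫ x in (0 : ℝ)..1, trigFun m x * trigFun n x = if m = n then 1 else 0 := by
  have hs : √2 * √2 = (2 : ℝ) := Real.mul_self_sqrt (by norm_num)
  have ic : ∀ k : ℤ, IntervalIntegrable (fun x : ℝ => Real.cos (2 * k * Real.pi * x)) volume 0 1 :=
    fun k => (by fun_prop : Continuous _).intervalIntegrable _ _
  have is : ∀ k : ℤ, IntervalIntegrable (fun x : ℝ => Real.sin (2 * k * Real.pi * x)) volume 0 1 :=
    fun k => (by fun_prop : Continuous _).intervalIntegrable _ _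
  -- products of cosines and sines
  have cc : ∀ a b : ℤ, ∫ x in (0 : ℝ)..1, (√2 * Real.cos (2 * a * Real.pi * x)) *
      (√2 * Real.cos (2 * b * Real.pi * x)) =
      (if a - b = 0 then 1 else 0) + (if a + b = 0 then 1 else 0) := by
    intro a b
    rw [← integral_cos_int (a - b), ← integral_cos_int (a + b),
      ← intervalIntegral.integral_add (ic _) (ic _)]
    congr 1; ext x
    push_cast
    rw [show 2 * ((a : ℝ) - b) * Real.pi * x = 2 * a * Real.pi * x - 2 * b * Real.pi * x by ring,
      show 2 * ((a : ℝ) + b) * Real.pi * x = 2 * a * Real.pi * x + 2 * b * Real.pi * x by ring,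
      Real.cos_sub, Real.cos_add]
    linear_combination (Real.cos (2 * a * Real.pi * x) * Real.cos (2 * b * Real.pi * x)) * hs
  have ss : ∀ a b : ℤ, ∫ x in (0 : ℝ)..1, (√2 * Real.sin (2 * a * Real.pi * x)) *
      (√2 * Real.sin (2 * b * Real.pi * x)) =
      (if a - b = 0 then 1 else 0) - (if a + b = 0 then 1 else 0) := by
    intro a b
    rw [← integral_cos_int (a - b), ← integral_cos_int (a + b),
      ← intervalIntegral.integral_sub (ic _) (ic _)]
    congr 1; ext x
    push_cast
    rw [show 2 * ((a : ℝ) - b) * Real.pi * x = 2 * a * Real.pi * x - 2 * b * Real.pi * x by ring,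
      show 2 * ((a : ℝ) + b) * Real.pi * x = 2 * a * Real.pi * x + 2 * b * Real.pi * x by ring,
      Real.cos_sub, Real.cos_add]
    linear_combination (Real.sin (2 * a * Real.pi * x) * Real.sin (2 * b * Real.pi * x)) * hs
  have sc : ∀ a b : ℤ, ∫ x in (0 : ℝ)..1, (√2 * Real.sin (2 * a * Real.pi * x)) *
      (√2 * Real.cos (2 * b * Real.pi * x)) = 0 := by
    intro a b
    have h0 : (0 : ℝ) = (∫ x in (0 : ℝ)..1, Real.sin (2 * (a - b : ℤ) * Real.pi * x)) +
        ∫ x in (0 : ℝ)..1, Real.sin (2 * (a + b : ℤ) * Real.pi * x) := by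
      rw [integral_sin_int, integral_sin_int, add_zero]
    refine Eq.trans ?_ h0.symm
    rw [← intervalIntegral.integral_add (is _) (is _)]
    congr 1; ext x
    push_cast
    rw [show 2 * ((a : ℝ) - b) * Real.pi * x = 2 * a * Real.pi * x - 2 * b * Real.pi * x by ring,
      show 2 * ((a : ℝ) + b) * Real.pi * x = 2 * a * Real.pi * x + 2 * b * Real.pi * x by ring,
      Real.sin_sub, Real.sin_add]
    linear_combination (Real.sin (2 * a * Real.pi * x) * Real.cos (2 * b * Real.pi * x)) * hs
  have c0 : ∀ b : ℤ, b ≠ 0 → ∫ x in (0 : ℝ)..1, √2 * Real.cos (2 * b * Real.pi * x) = 0 := by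
    intro b hb
    rw [intervalIntegral.integral_const_mul, integral_cos_int, if_neg hb, mul_zero]
  have s0 : ∀ b : ℤ, ∫ x in (0 : ℝ)..1, √2 * Real.sin (2 * b * Real.pi * x) = 0 := by
    intro b
    rw [intervalIntegral.integral_const_mul, integral_sin_int, mul_zero]
  have tp : ∀ k : ℤ, 0 < k → trigFun k = fun x => √2 * Real.cos (2 * k * Real.pi * x) := by
    intro k hk; ext x; simp [trigFun, hk, hk.ne']
  have tn : ∀ k : ℤ, k < 0 → trigFun k =
      fun x => √2 * Real.sin (2 * (-k : ℤ) * Real.pi * x) := by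
    intro k hk; ext x; simp [trigFun, hk.not_gt, hk.ne]
  have tz : trigFun 0 = fun _ => 1 := by ext x; simp [trigFun]
  rcases lt_trichotomy m 0 with hm | rfl | hm <;> rcases lt_trichotomy n 0 with hn | rfl | hn
  · rw [tn m hm, tn n hn]
    have h1 : (-m + -n = 0) = False := by simp; omega
    have h2 : (-m - -n = 0) = (m = n) := by apply propext; omega
    simp only [ss, h1, h2, if_false, sub_zero]
  · rw [tn m hm, tz, if_neg hm.ne]; simpa using s0 (-m)
  · rw [tn m hm, tp n hn, if_neg (by omega)]; exact sc _ _
  · rw [tn n hn, tz, if_neg hn.ne']; simpa using s0 (-n)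
  · simp [tz]
  · rw [tp n hn, tz, if_neg hn.ne]; simpa using c0 n hn.ne'
  · rw [tp m hm, tn n hn, if_neg (by omega)]
    simp_rw [mul_comm (√2 * Real.cos _)]; exact sc _ _
  · rw [tp m hm, tz, if_neg hm.ne']; simpa using c0 m hm.ne'
  · rw [tp m hm, tp n hn]
    have h1 : (m + n = 0) = False := by simp; omega
    have h2 : (m - n = 0) = (m = n) := by apply propext; omega
    simp only [cc, h1, h2, if_false, add_zero]

theorem orthonormal_e : Orthonormal ℝ e := by
  rw [orthonormal_iff_ite]
  intro m n
  rw [inner_e, ← integral_trigFun_mul, intervalIntegral.integral_of_le zero_le_one,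
    intervalIntegral.integral_of_le zero_le_one, integral_Ioc_eq_integral_Ioo,
    integral_Ioc_eq_integral_Ioo]
  apply integral_congr_ae
  filter_upwards [(memLp_trigFun n).coeFn_toLp] with x hx
  simp only [e, hx]

theorem eq_zero_of_inner_e_eq_zero (v : H) (hv : ∀ n, ⟪e n, v⟫ = 0) : v = 0 := by
  have hvL : MemLp v 2 (volume.restrict (Ioc (0 : ℝ) 1)) := by
    rw [← Measure.restrict_congr_set (Ioo_ae_eq_Ioc (a := (0 : ℝ)) (b := 1))]
    exact Lp.memLp v
  have hint : IntervalIntegrable v volume 0 1 := by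
    rw [intervalIntegrable_iff_integrableOn_Ioc_of_le zero_le_one]
    exact hvL.integrable (by norm_num)
  have h2 : √2 ≠ (0 : ℝ) := by positivity
  have hc : ∀ k : ℤ, 0 ≤ k → ∫ x in (0 : ℝ)..1, Real.cos (2 * k * Real.pi * x) * v x = 0 := by
    intro k hk
    rcases hk.eq_or_lt with rfl | hk
    · have := hv 0
      rw [inner_e] at this
      simpa [trigFun] using this
    · have := hv k
      rw [inner_e] at this
      simpa [trigFun, hk, hk.ne', mul_assoc, intervalIntegral.integral_const_mul] using this
  have hs : ∀ k : ℤ, 0 < k → ∫ x in (0 : ℝ)..1, Real.sin (2 * k * Real.pi * x) * v x = 0 := by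
    intro k hk
    have := hv (-k)
    rw [inner_e] at this
    simpa [trigFun, hk, hk.ne', hk.le, hk.not_gt, mul_assoc, intervalIntegral.integral_const_mul] using this
  have hc' : ∀ k : ℤ, ∫ x in (0 : ℝ)..1, Real.cos (2 * k * Real.pi * x) * v x = 0 := by
    intro k
    rcases le_or_gt 0 k with hk | hk
    · exact hc k hk
    · refine Eq.trans ?_ (hc (-k) (by omega))
      congr 1; ext x; rw [← Real.cos_neg]; push_cast; ring_nf
  have hs' : ∀ k : ℤ, ∫ x in (0 : ℝ)..1, Real.sin (2 * k * Real.pi * x) * v x = 0 := by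
    intro k
    rcases lt_trichotomy 0 k with hk | rfl | hk
    · exact hs k hk
    · simp
    · rw [← neg_eq_zero, ← intervalIntegral.integral_neg]
      refine Eq.trans ?_ (hs (-k) (by omega))
      congr 1; ext x; rw [← neg_mul, ← Real.sin_neg]; push_cast; ring_nf
  have hmem : MemLp (fun x => (v x : ℂ)) 2 (volume.restrict (Ioc (0 : ℝ) 1)) := hvL.ofReal
  have hcoef : ∀ n, fourierCoeffOn zero_lt_one (fun x => (v x : ℂ)) n = 0 := by
    intro n
    rw [fourierCoeffOn_eq_integral]
    have key : ∀ x : ℝ, fourier (-n) (x : AddCircle ((1 : ℝ) - 0)) • (v x : ℂ) =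
        ((Real.cos (2 * n * Real.pi * x) * v x : ℝ) : ℂ) -
          Complex.I * ((Real.sin (2 * n * Real.pi * x) * v x : ℝ) : ℂ) := by
      intro x
      rw [fourier_coe_apply, show (2 * Real.pi * Complex.I * ((-n : ℤ) : ℂ) * x / ((1 - 0 : ℝ) : ℂ))
        = ((-(2 * n * Real.pi * x) : ℝ) : ℂ) * Complex.I by push_cast; ring, Complex.exp_mul_I,
        ← Complex.ofReal_cos, ← Complex.ofReal_sin, Real.cos_neg, Real.sin_neg, smul_eq_mul]
      push_cast; ring
    have i1 : IntervalIntegrable (fun x => Real.cos (2 * n * Real.pi * x) * v x) volume 0 1 :=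
      hint.continuousOn_mul (by fun_prop)
    have i2 : IntervalIntegrable (fun x => Real.sin (2 * n * Real.pi * x) * v x) volume 0 1 :=
      hint.continuousOn_mul (by fun_prop)
    have i1' : IntervalIntegrable (fun x =>
        ((Real.cos (2 * n * Real.pi * x) * v x : ℝ) : ℂ)) volume 0 1 := ⟨i1.1.ofReal, i1.2.ofReal⟩
    have i2' : IntervalIntegrable (fun x =>
        ((Real.sin (2 * n * Real.pi * x) * v x : ℝ) : ℂ)) volume 0 1 := ⟨i2.1.ofReal, i2.2.ofReal⟩
    simp_rw [key]
    rw [intervalIntegral.integral_sub i1' (i2'.const_mul _),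
      intervalIntegral.integral_const_mul, intervalIntegral.integral_ofReal,
      intervalIntegral.integral_ofReal, hc', hs']
    simp
  have hP := hasSum_sq_fourierCoeffOn zero_lt_one hmem
  simp_rw [hcoef] at hP
  have h0 : ∫ x in (0 : ℝ)..1, ‖(v x : ℂ)‖ ^ 2 = 0 := by
    have h3 : HasSum (fun _ : ℤ => ‖(0 : ℂ)‖ ^ 2) 0 := by
      simp only [norm_zero, ne_eq, OfNat.ofNat_ne_zero, not_false_eq_true, zero_pow]
      exact hasSum_zero
    have := hP.unique h3
    simpa using this
  have hn : ⟪v, v⟫ = 0 := by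
    rw [L2.inner_def, ← h0, intervalIntegral.integral_of_le zero_le_one,
      integral_Ioc_eq_integral_Ioo]
    congr 1; ext x
    simp [pow_two]
  exact inner_self_eq_zero.1 hn

/-- The family `(e_n)` is an orthonormal basis of `H`. -/
def eBasis : HilbertBasis ℤ ℝ H :=
  HilbertBasis.mkOfOrthogonalEqBot orthonormal_e (by
    rw [Submodule.eq_bot_iff]
    intro v hv
    refine eq_zero_of_inner_e_eq_zero v fun n => ?_
    exact (Submodule.mem_orthogonal _ v).1 hv _ (Submodule.subset_span ⟨n, rfl⟩))

theorem coe_eBasis : ⇑eBasis = e := HilbertBasis.coe_mkOfOrthogonalEqBot _ _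

/-! ### The periodic Laplacian -/

/-- The eigenvalue `-4π²n²` of the Laplacian belonging to `e_n`. -/
def lapEig (n : ℤ) : ℝ := -4 * Real.pi ^ 2 * (n : ℝ) ^ 2

theorem memℓp_two_iff (f : ℤ → ℝ) : Memℓp f 2 ↔ Summable fun n => f n ^ 2 := by
  rw [memℓp_gen_iff (by norm_num)]
  simp

theorem inner_e_eq_repr (n : ℤ) (v : H) : ⟪e n, v⟫ = eBasis.repr v n := by
  rw [HilbertBasis.repr_apply_apply, coe_eBasis]

/-- The domain `{v ∈ H : ∑ n⁴ |⟨e_n, v⟩|² < ∞}` of the Laplacian. -/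
def laplacianDomain : Submodule ℝ H where
  carrier := {v | Summable fun n : ℤ => (n : ℝ) ^ 4 * ⟪e n, v⟫ ^ 2}
  zero_mem' := by simp [summable_zero]
  add_mem' := by
    intro v w hv hw
    have hv' := (memℓp_two_iff (fun n : ℤ => (n : ℝ) ^ 2 * ⟪e n, v⟫)).2
      (Summable.congr hv fun n => by ring)
    have hw' := (memℓp_two_iff (fun n : ℤ => (n : ℝ) ^ 2 * ⟪e n, w⟫)).2
      (Summable.congr hw fun n => by ring)
    exact ((memℓp_two_iff _).1 (hv'.add hw')).congr fun n => by
      simp only [Pi.add_apply, inner_add_right]; ring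
  smul_mem' := by
    intro c v hv
    exact (Summable.mul_left (c ^ 2) hv).congr fun n => by rw [inner_smul_right]; ring

theorem memℓp_lapEig_mul (v : laplacianDomain) :
    Memℓp (fun n => lapEig n * ⟪e n, (v : H)⟫) 2 := by
  rw [memℓp_two_iff]
  exact (Summable.mul_left (16 * Real.pi ^ 4) v.2).congr fun n => by
    simp only [lapEig]; ring

/-- The Laplacian with periodic boundary conditions, `A v = ∑ -4π²n² ⟨e_n, v⟩ e_n`. -/
def laplacian : H →ₗ.[ℝ] H where
  domain := laplacianDomain
  toFun :=
    { toFun := fun v => eBasis.repr.symm ⟨_, memℓp_lapEig_mul v⟩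
      map_add' := by
        intro v w
        rw [← map_add]; congr 1; ext n
        change lapEig n * ⟪e n, ((v + w : laplacianDomain) : H)⟫ =
          lapEig n * ⟪e n, (v : H)⟫ + lapEig n * ⟪e n, (w : H)⟫
        rw [Submodule.coe_add, inner_add_right]; ring
      map_smul' := by
        intro c v
        rw [RingHom.id_apply, ← map_smul]; congr 1; ext n
        change lapEig n * ⟪e n, ((c • v : laplacianDomain) : H)⟫ =
          c * (lapEig n * ⟪e n, (v : H)⟫)
        rw [Submodule.coe_smul, inner_smul_right]; ring }

theorem laplacian_hasSum (v : laplacian.domain) :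
    HasSum (fun n => (lapEig n * ⟪e n, (v : H)⟫) • e n) (laplacian v) := by
  have := eBasis.hasSum_repr (laplacian v)
  rw [coe_eBasis] at this
  convert this using 3 with n
  change _ = eBasis.repr (eBasis.repr.symm ⟨_, memℓp_lapEig_mul v⟩) n
  rw [LinearIsometryEquiv.apply_symm_apply]

/-- The eigenvalue `η + 4π²n²` of `η - A` belonging to `e_n`. -/
def weight (η : ℝ) (n : ℤ) : ℝ := η - lapEig n

theorem inner_e_sub_laplacian (η : ℝ) (v : laplacian.domain) (n : ℤ) :
    ⟪e n, η • (v : H) - laplacian v⟫ = weight η n * ⟪e n, (v : H)⟫ := by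
  have h : ⟪e n, laplacian v⟫ = lapEig n * ⟪e n, (v : H)⟫ := by
    rw [inner_e_eq_repr n (laplacian v)]
    change eBasis.repr (eBasis.repr.symm ⟨_, memℓp_lapEig_mul v⟩) n = _
    rw [LinearIsometryEquiv.apply_symm_apply]
  rw [inner_sub_right, inner_smul_right, h, weight]; ring

theorem le_weight (η : ℝ) (n : ℤ) : η ≤ weight η n := by
  have : 0 ≤ 4 * Real.pi ^ 2 * (n : ℝ) ^ 2 := by positivity
  simp only [weight, lapEig]; linarith

theorem weight_pos (η : ℝ) [hη : Fact (0 < η)] (n : ℤ) : 0 < weight η n :=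
  hη.out.trans_le (le_weight η n)

/-! ### The interpolation spaces associated to `η - A` -/

/-- Coefficient sequences `u` with `∑ (η + 4π²n²)^{2r} |u_n|² < ∞`. -/
def hSeq (η r : ℝ) : Submodule ℝ (ℤ → ℝ) where
  carrier := {u | Memℓp (fun n => weight η n ^ r * u n) 2}
  zero_mem' := by
    have : Memℓp (0 : ℤ → ℝ) 2 := zero_memℓp
    simp only [Set.mem_ofPred_eq]
    convert this using 1
    ext n; simp
  add_mem' := by
    intro u v hu hv
    have := hu.add hv
    simp only [Set.mem_ofPred_eq]
    convert this using 1
    ext n; simp only [Pi.add_apply]; ring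
  smul_mem' := by
    intro c u hu
    have := hu.const_smul c
    simp only [Set.mem_ofPred_eq]
    convert this using 1
    ext n; simp only [Pi.smul_apply, smul_eq_mul]; ring

/-- The interpolation space `H_r` associated to `η - A`: the space of all formal Fourier series
`∑ u_n e_n` with `‖u‖²_{H_r} = ∑ (η + 4π²n²)^{2r} |u_n|² < ∞`. For `r ≥ 0` it is the domain of
`(η - A)^r` with the norm `‖(η - A)^r v‖_H`, and for `r ≤ 0` it is the completion of `H` with respect
to the norm `‖(η - A)^r v‖_H`. -/
def InterpSpace (η r : ℝ) : Type := hSeq η r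

namespace InterpSpace

variable {η r s : ℝ}

instance : AddCommGroup (InterpSpace η r) := inferInstanceAs (AddCommGroup (hSeq η r))
instance : Module ℝ (InterpSpace η r) := inferInstanceAs (Module ℝ (hSeq η r))

/-- The `n`-th Fourier coefficient of an element of `H_r`. -/
def coeff (u : InterpSpace η r) (n : ℤ) : ℝ := Subtype.val u n

@[ext] theorem ext {u v : InterpSpace η r} (h : ∀ n, u.coeff n = v.coeff n) : u = v :=
  Subtype.ext (funext h)

/-- The element of `H_r` with given Fourier coefficients. -/
def mk (u : ℤ → ℝ) (hu : Memℓp (fun n => weight η n ^ r * u n) 2) : InterpSpace η r := ⟨u, hu⟩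

@[simp] theorem coeff_mk (u : ℤ → ℝ) (hu : Memℓp (fun n => weight η n ^ r * u n) 2) (n : ℤ) :
    (mk u hu : InterpSpace η r).coeff n = u n := rfl
@[simp] theorem coeff_add (u v : InterpSpace η r) (n : ℤ) :
    (u + v).coeff n = u.coeff n + v.coeff n := rfl
@[simp] theorem coeff_smul (c : ℝ) (u : InterpSpace η r) (n : ℤ) :
    (c • u).coeff n = c * u.coeff n := rfl

theorem memℓp_coeff (u : InterpSpace η r) : Memℓp (fun n => weight η n ^ r * u.coeff n) 2 := u.2

/-- The map `u ↦ ((η + 4π²n²)^r u_n)_n` from `H_r` to `ℓ²(ℤ)`; it induces the norm of `H_r`. -/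
def toSeq (η r : ℝ) : InterpSpace η r →ₗ[ℝ] lp (fun _ : ℤ => ℝ) 2 where
  toFun u := ⟨_, u.memℓp_coeff⟩
  map_add' u v := by
    ext n
    change weight η n ^ r * (u + v).coeff n =
      weight η n ^ r * u.coeff n + weight η n ^ r * v.coeff n
    rw [coeff_add]; ring
  map_smul' c u := by
    ext n
    change weight η n ^ r * (c • u).coeff n = c * (weight η n ^ r * u.coeff n)
    rw [coeff_smul]; ring

theorem toSeq_apply (u : InterpSpace η r) (n : ℤ) : toSeq η r u n = weight η n ^ r * u.coeff n := rfl

variable [hη : Fact (0 < η)]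

theorem toSeq_injective : Function.Injective (toSeq η r) := by
  intro u v h
  ext n
  have h1 : toSeq η r u n = toSeq η r v n := by rw [h]
  rw [toSeq_apply, toSeq_apply] at h1
  exact mul_left_cancel₀ (Real.rpow_pos_of_pos (weight_pos η n) r).ne' h1

theorem toSeq_surjective : Function.Surjective (toSeq η r) := by
  intro f
  have hw : ∀ n, weight η n ^ r ≠ 0 := fun n => (Real.rpow_pos_of_pos (weight_pos η n) r).ne'
  refine ⟨mk (fun n => (weight η n ^ r)⁻¹ * f n) ?_, ?_⟩
  · have := lp.memℓp f
    convert this using 1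
    ext n; rw [← mul_assoc, mul_inv_cancel₀ (hw n), one_mul]
  · ext n
    rw [toSeq_apply, coeff_mk, ← mul_assoc, mul_inv_cancel₀ (hw n), one_mul]

instance : NormedAddCommGroup (InterpSpace η r) :=
  NormedAddCommGroup.induced _ _ (toSeq η r) toSeq_injective

instance : InnerProductSpace ℝ (InterpSpace η r) := InnerProductSpace.induced (toSeq η r)

theorem norm_def (u : InterpSpace η r) : ‖u‖ = ‖toSeq η r u‖ := rfl

/-- `H_r` is isometrically isomorphic to `ℓ²(ℤ)`. -/
def seqEquiv (η r : ℝ) [Fact (0 < η)] : InterpSpace η r ≃ₗᵢ[ℝ] lp (fun _ : ℤ => ℝ) 2 where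
  toLinearEquiv := LinearEquiv.ofBijective (toSeq η r) ⟨toSeq_injective, toSeq_surjective⟩
  norm_map' _ := rfl

instance : CompleteSpace (InterpSpace η r) :=
  (seqEquiv η r).toIsometryEquiv.completeSpace

instance : MeasurableSpace (InterpSpace η r) := borel _
instance : BorelSpace (InterpSpace η r) := ⟨rfl⟩

theorem hasSum_norm_sq (u : InterpSpace η r) :
    HasSum (fun n => weight η n ^ (2 * r) * u.coeff n ^ 2) (‖u‖ ^ 2) := by
  have h := lp.hasSum_norm (p := 2) (by norm_num) (toSeq η r u)
  rw [← norm_def] at h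
  convert h using 1
  · ext n
    rw [toSeq_apply, ENNReal.toReal_ofNat, Real.rpow_ofNat, Real.norm_eq_abs, sq_abs, mul_pow,
      ← Real.rpow_natCast (weight η n ^ r), ← Real.rpow_mul (weight_pos η n).le]
    congr 2; push_cast; ring
  · rw [ENNReal.toReal_ofNat, Real.rpow_ofNat]

theorem inner_eq_tsum (u v : InterpSpace η r) :
    ⟪u, v⟫ = ∑' n, weight η n ^ (2 * r) * (u.coeff n * v.coeff n) := by
  have h : ⟪u, v⟫ = ⟪toSeq η r u, toSeq η r v⟫ := rfl
  rw [h, lp.inner_eq_tsum]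
  congr 1; ext n
  rw [toSeq_apply, toSeq_apply, two_mul, Real.rpow_add (weight_pos η n)]
  simp only [RCLike.inner_apply, conj_trivial]; ring

theorem sq_weight_le {a : ℝ} (h : s + a ≤ r) (n : ℤ) (x : ℝ) :
    weight η n ^ (2 * s) * (weight η n ^ a * x) ^ 2 ≤
      η ^ (2 * (s + a - r)) * (weight η n ^ (2 * r) * x ^ 2) := by
  have hw := weight_pos η n
  have h1 : weight η n ^ (2 * s) * (weight η n ^ a * x) ^ 2 =
      weight η n ^ (2 * (s + a - r)) * (weight η n ^ (2 * r) * x ^ 2) := by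
    rw [mul_pow, ← Real.rpow_natCast (weight η n ^ a), ← Real.rpow_mul hw.le, ← mul_assoc,
      ← mul_assoc, ← Real.rpow_add hw, ← Real.rpow_add hw]
    congr 2; push_cast; ring
  rw [h1]
  refine mul_le_mul_of_nonneg_right ?_ (by positivity)
  exact Real.rpow_le_rpow_of_nonpos hη.out (le_weight η n) (by linarith)

/-- The bounded operator `(η - A)^a : H_r → H_s` for `s + a ≤ r`, acting on Fourier coefficients as
multiplication with `(η + 4π²n²)^a`. -/
def fracPow (a : ℝ) (h : s + a ≤ r) : InterpSpace η r →L[ℝ] InterpSpace η s :=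
  LinearMap.mkContinuous
    { toFun := fun u => mk (fun n => weight η n ^ a * u.coeff n) (by
        rw [memℓp_two_iff]
        refine Summable.of_nonneg_of_le (fun n => sq_nonneg _) (fun n => ?_)
          (u.hasSum_norm_sq.summable.mul_left (η ^ (2 * (s + a - r))))
        refine le_trans (le_of_eq ?_) (sq_weight_le h n (u.coeff n))
        rw [mul_pow, ← Real.rpow_natCast (weight η n ^ s), ← Real.rpow_mul (weight_pos η n).le]
        congr 2; push_cast; ring)
      map_add' := fun u v => by ext n; simp only [coeff_mk, coeff_add]; ring
      map_smul' := fun c u => by ext n; simp only [coeff_mk, coeff_smul, RingHom.id_apply]; ring }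
    (η ^ (s + a - r)) (fun u => by
      have hη0 := hη.out
      refine (sq_le_sq₀ (norm_nonneg _) (by positivity)).1 ?_
      rw [mul_pow, ← Real.rpow_natCast (η ^ (s + a - r)), ← Real.rpow_mul hη0.le]
      refine le_trans (hasSum_le (fun n => ?_) (hasSum_norm_sq _)
        (u.hasSum_norm_sq.mul_left (η ^ (2 * (s + a - r))))) (le_of_eq ?_)
      · exact sq_weight_le h n (u.coeff n)
      · congr 2; push_cast; ring)

@[simp] theorem coeff_fracPow (a : ℝ) (h : s + a ≤ r) (u : InterpSpace η r) (n : ℤ) :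
    (fracPow a h u : InterpSpace η s).coeff n = weight η n ^ a * u.coeff n := rfl

/-- The continuous inclusion `H_r ⊆ H_s` for `s ≤ r`. -/
def incl (h : s ≤ r) : InterpSpace η r →L[ℝ] InterpSpace η s := fracPow 0 (by simpa using h)

@[simp] theorem coeff_incl (h : s ≤ r) (u : InterpSpace η r) (n : ℤ) :
    (incl h u : InterpSpace η s).coeff n = u.coeff n := by simp [incl]

/-- The identification `H_0 = H`. -/
def equivL2 (η : ℝ) [Fact (0 < η)] : InterpSpace η 0 ≃ₗᵢ[ℝ] H :=
  (seqEquiv η 0).trans eBasis.repr.symm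

theorem coeff_equivL2_symm (v : H) (n : ℤ) : ((equivL2 η).symm v).coeff n = ⟪e n, v⟫ := by
  have h : seqEquiv η 0 ((equivL2 η).symm v) n = eBasis.repr v n := by simp [equivL2]
  rw [inner_e_eq_repr, ← h]
  change _ = toSeq η 0 _ n
  simp [toSeq_apply]

theorem inner_e_equivL2 (u : InterpSpace η 0) (n : ℤ) : ⟪e n, equivL2 η u⟫ = u.coeff n := by
  rw [← coeff_equivL2_symm (η := η), LinearIsometryEquiv.symm_apply_apply]

/-- The embedding `H ⊆ H_r` for `r ≤ 0`; the `n`-th coefficient of `v ∈ H` is `⟨e_n, v⟩_H`. -/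
def ofL2 (η : ℝ) [Fact (0 < η)] (hr : r ≤ 0) : H →L[ℝ] InterpSpace η r :=
  (incl hr).comp (equivL2 η).symm.toContinuousLinearEquiv.toContinuousLinearMap

@[simp] theorem coeff_ofL2 (hr : r ≤ 0) (v : H) (n : ℤ) :
    (ofL2 η hr v : InterpSpace η r).coeff n = ⟪e n, v⟫ := by
  change (incl hr ((equivL2 η).symm v)).coeff n = _
  rw [coeff_incl, coeff_equivL2_symm]

/-- The basis vector `e_n`, viewed as an element of `H_r`. -/
def basisVec (η r : ℝ) [Fact (0 < η)] (n : ℤ) : InterpSpace η r :=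
  (seqEquiv η r).symm (lp.single (E := fun _ : ℤ => ℝ) 2 n (weight η n ^ r))

theorem coeff_basisVec (n m : ℤ) : (basisVec η r n).coeff m = if m = n then 1 else 0 := by
  have h : seqEquiv η r (basisVec η r n) m =
      lp.single (E := fun _ : ℤ => ℝ) 2 n (weight η n ^ r) m := by simp [basisVec]
  change toSeq η r (basisVec η r n) m = _ at h
  have hw := (Real.rpow_pos_of_pos (weight_pos η m) r).ne'
  rw [toSeq_apply, lp.single_apply] at h
  split_ifs with hmn
  · subst hmn
    simp only [Pi.single_eq_same] at h
    exact mul_left_cancel₀ hw (by rw [h, mul_one])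
  · rw [Pi.single_eq_of_ne hmn] at h
    exact (mul_eq_zero.1 h).resolve_left hw

/-- For `r ≤ 0` the space `H` is dense in `H_r`. -/
theorem denseRange_ofL2 (hr : r ≤ 0) : DenseRange (ofL2 η hr) := by
  intro u
  have h := (lp.hasSum_single (p := 2) (by norm_num) (seqEquiv η r u)).mapL
    (seqEquiv η r).symm.toContinuousLinearEquiv.toContinuousLinearMap
  have hu : (seqEquiv η r).symm (seqEquiv η r u) = u := LinearIsometryEquiv.symm_apply_apply _ _
  change HasSum _ ((seqEquiv η r).symm (seqEquiv η r u)) at h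
  rw [hu] at h
  refine mem_closure_of_tendsto h (Eventually.of_forall fun F => ?_)
  refine (LinearMap.range (ofL2 η hr).toLinearMap).sum_mem fun n _ => ⟨u.coeff n • e n, ?_⟩
  have h1 : ofL2 η hr (e n) = basisVec η r n := by
    ext m
    rw [coeff_ofL2, coeff_basisVec, orthonormal_iff_ite.1 orthonormal_e]
  have h2 : lp.single (E := fun _ : ℤ => ℝ) 2 n (seqEquiv η r u n) =
      u.coeff n • lp.single (E := fun _ : ℤ => ℝ) 2 n (weight η n ^ r) := by
    rw [← lp.single_smul, smul_eq_mul, mul_comm]; rfl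
  change ofL2 η hr (u.coeff n • e n) = (seqEquiv η r).symm (lp.single 2 n (seqEquiv η r u n))
  rw [h2, map_smul, map_smul, h1]; rfl

/-- The continuous functional `u ↦ u_n` on `H_r`. -/
def coeffCLM (η r : ℝ) [Fact (0 < η)] (n : ℤ) : InterpSpace η r →L[ℝ] ℝ :=
  LinearMap.mkContinuous
    { toFun := fun u => u.coeff n
      map_add' := fun _ _ => rfl
      map_smul' := fun _ _ => rfl } ((weight η n ^ r)⁻¹) (fun u => by
    have hw := Real.rpow_pos_of_pos (weight_pos η n) r
    have h := lp.norm_apply_le_norm (p := 2) (by norm_num) (toSeq η r u) n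
    rw [← norm_def, toSeq_apply, norm_mul, Real.norm_of_nonneg hw.le] at h
    change ‖u.coeff n‖ ≤ _
    rw [inv_mul_eq_div, le_div_iff₀ hw]
    linarith)

/-- The spectral Galerkin projection `P_N`, `P_N u = ∑_{|n| ≤ N} u_n e_n`, as a bounded operator from
`H_r` to `H_s`. -/
def galerkin (η r s : ℝ) [Fact (0 < η)] (N : ℕ) : InterpSpace η r →L[ℝ] InterpSpace η s :=
  ∑ n ∈ Finset.Icc (-(N : ℤ)) N, (coeffCLM η r n).smulRight (basisVec η s n)

theorem galerkin_apply (N : ℕ) (u : InterpSpace η r) :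
    galerkin η r s N u = ∑ n ∈ Finset.Icc (-(N : ℤ)) N, u.coeff n • basisVec η s n := by
  simp only [galerkin, sum_apply, ContinuousLinearMap.smulRight_apply]
  rfl

/-- On `H` the projection is `P_N v = ∑_{|n| ≤ N} ⟨e_n, v⟩ e_n`. -/
theorem galerkin_L2 (N : ℕ) (v : H) :
    equivL2 η (galerkin η 0 0 N ((equivL2 η).symm v)) =
      ∑ n ∈ Finset.Icc (-(N : ℤ)) N, ⟪e n, v⟫ • e n := by
  rw [galerkin_apply, map_sum]
  refine Finset.sum_congr rfl fun n _ => ?_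
  rw [map_smul, coeff_equivL2_symm]
  congr 1
  rw [← LinearIsometryEquiv.eq_symm_apply]
  ext m
  rw [coeff_basisVec, coeff_equivL2_symm, orthonormal_iff_ite.1 orthonormal_e]

end InterpSpace

namespace InterpSpace

variable {η : ℝ} [hη : Fact (0 < η)]

/-- `H_1 = D(A)` as subspaces of `H`. -/
theorem mem_laplacian_domain_iff (v : H) :
    v ∈ laplacian.domain ↔
      ∃ u : InterpSpace η 1, equivL2 η (incl zero_le_one u) = v := by
  constructor
  · intro hv
    have h := lp.memℓp (eBasis.repr (η • v - laplacian ⟨v, hv⟩))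
    refine ⟨mk (fun n => ⟪e n, v⟫) ?_, ?_⟩
    · have h1 : (fun n => weight η n ^ (1 : ℝ) * ⟪e n, v⟫) =
          fun n => eBasis.repr (η • v - laplacian ⟨v, hv⟩) n := by
        ext n
        rw [← inner_e_eq_repr, inner_e_sub_laplacian η ⟨v, hv⟩, Real.rpow_one]
      rw [h1]; exact h
    · rw [← LinearIsometryEquiv.eq_symm_apply]
      ext n
      rw [coeff_equivL2_symm, coeff_incl, coeff_mk]
  · rintro ⟨u, rfl⟩
    change Summable fun n : ℤ => (n : ℝ) ^ 4 * ⟪e n, equivL2 η (incl zero_le_one u)⟫ ^ 2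
    refine Summable.of_nonneg_of_le (fun n => by positivity) (fun n => ?_) u.hasSum_norm_sq.summable
    rw [inner_e_equivL2, coeff_incl]
    refine mul_le_mul_of_nonneg_right ?_ (sq_nonneg _)
    have h2 : (n : ℝ) ^ 2 ≤ weight η n := by
      have hpi : (1 : ℝ) ≤ 4 * Real.pi ^ 2 := by nlinarith [Real.pi_gt_three]
      have := mul_le_mul_of_nonneg_right hpi (sq_nonneg (n : ℝ))
      have := hη.out
      simp only [weight, lapEig]; linarith
    rw [mul_one, Real.rpow_two, show (n : ℝ) ^ 4 = ((n : ℝ) ^ 2) ^ 2 by ring]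
    exact pow_le_pow_left₀ (sq_nonneg _) h2 2

/-- The norm of `H_1` is `‖(η - A) v‖_H`. -/
theorem norm_eq_norm_sub_laplacian (u : InterpSpace η 1)
    (h : equivL2 η (incl zero_le_one u) ∈ laplacian.domain) :
    ‖u‖ = ‖η • equivL2 η (incl zero_le_one u) - laplacian ⟨_, h⟩‖ := by
  rw [norm_def, ← eBasis.repr.norm_map]
  congr 1
  ext n
  rw [← inner_e_eq_repr, inner_e_sub_laplacian η ⟨_, h⟩, toSeq_apply, Real.rpow_one]
  simp only [inner_e_equivL2, coeff_incl]

end InterpSpace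

/-! ### The polynomial nonlinearity -/

open Classical in
/-- The polynomial nonlinearity `v ↦ ∑_{k ≤ q} a_k v^k`, with pointwise powers, as an element of `H`.
It is used for trigonometric polynomials `v` only, for which the right-hand side is square
integrable, see `memLp_polyFun`. -/
def polyNonlin (q : ℕ) (a : ℕ → ℝ) (v : H) : H :=
  if h : MemLp (fun x => ∑ k ∈ Finset.range (q + 1), a k * (v x) ^ k) 2 unitMeasure
  then h.toLp _ else 0

theorem memLp_polyFun (q : ℕ) (a : ℕ → ℝ) (v : H) (hv : v ∈ Submodule.span ℝ (Set.range e)) :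
    MemLp (fun x => ∑ k ∈ Finset.range (q + 1), a k * (v x) ^ k) 2 unitMeasure := by
  obtain ⟨C, hC⟩ : ∃ C, ∀ᵐ x ∂unitMeasure, |v x| ≤ C := by
    induction hv using Submodule.span_induction with
    | mem w hw =>
      obtain ⟨n, rfl⟩ := hw
      refine ⟨√2, ?_⟩
      filter_upwards [(memLp_trigFun n).coeFn_toLp] with x hx
      rw [e, hx]; exact abs_trigFun_le n x
    | zero =>
      refine ⟨0, ?_⟩
      filter_upwards [Lp.coeFn_zero ℝ 2 unitMeasure] with x hx
      rw [hx]; simp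
    | add u w _ _ hu hw =>
      obtain ⟨C, hC⟩ := hu
      obtain ⟨D, hD⟩ := hw
      refine ⟨C + D, ?_⟩
      filter_upwards [hC, hD, Lp.coeFn_add u w] with x h1 h2 h3
      rw [h3]; exact (abs_add_le _ _).trans (add_le_add h1 h2)
    | smul c u _ hu =>
      obtain ⟨C, hC⟩ := hu
      refine ⟨|c| * C, ?_⟩
      filter_upwards [hC, Lp.coeFn_smul c u] with x h1 h2
      rw [h2, Pi.smul_apply, smul_eq_mul, abs_mul]
      exact mul_le_mul_of_nonneg_left h1 (abs_nonneg c)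
  have hm := (Lp.aestronglyMeasurable v)
  refine MemLp.of_bound ?_ (∑ k ∈ Finset.range (q + 1), |a k| * C ^ k) ?_
  · have : Continuous fun y : ℝ => ∑ k ∈ Finset.range (q + 1), a k * y ^ k := by fun_prop
    exact this.comp_aestronglyMeasurable hm
  · filter_upwards [hC] with x hx
    refine (norm_sum_le _ _).trans (Finset.sum_le_sum fun k _ => ?_)
    rw [norm_mul, norm_pow, Real.norm_eq_abs, Real.norm_eq_abs]
    gcongr

/-! ### Cylindrical Wiener processes -/

/-- Let `J : U → V` be the embedding of a Hilbert space `U` into a larger Hilbert space `V`. A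
`V`-valued process `W` on `[0,T]` is an `Id_U`-cylindrical Wiener process if it is a `Q`-Wiener
process in `V` with covariance operator `Q = J J*`: it starts at `0`, has continuous paths,
independent increments, and `W_t - W_s` is centered Gaussian with covariance `(t - s) J J*`, i.e. for
every `x ∈ V` the real random variable `⟨x, W_t - W_s⟩_V` has the law
`N(0, (t - s) ⟨x, J J* x⟩_V) = N(0, (t - s) ‖J* x‖²_U)`. -/
structure IsCylindricalWiener {Ω U V : Type*} [MeasurableSpace Ω]
    [NormedAddCommGroup U] [InnerProductSpace ℝ U] [CompleteSpace U]
    [NormedAddCommGroup V] [InnerProductSpace ℝ V] [CompleteSpace V]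
    [MeasurableSpace V] [BorelSpace V]
    (J : U →L[ℝ] V) (T : ℝ) (W : ℝ → Ω → V) (P : Measure Ω) : Prop where
  measurable : ∀ t ∈ Icc 0 T, Measurable (W t)
  zero : ∀ᵐ ω ∂P, W 0 ω = 0
  continuous : ∀ᵐ ω ∂P, ContinuousOn (fun t => W t ω) (Icc 0 T)
  indep : HasIndepIncrements (fun (t : Icc (0 : ℝ) T) ω => W t ω) P
  gaussian : ∀ s t, 0 ≤ s → s ≤ t → t ≤ T → ∀ x : V,
    HasLaw (fun ω => ⟪x, W t ω - W s ω⟫)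
      (gaussianReal 0 ((t - s) * ‖ContinuousLinearMap.adjoint J x‖ ^ 2).toNNReal) P

theorem neg_nu_nonpos {ν : ℝ} (hν : ν ∈ Ioo (1 / 4 : ℝ) (3 / 4)) : -ν ≤ 0 := by
  linarith [hν.1]

end SpectralSPDE

end

open SpectralSPDE

/-!
Why the moments explode. Write `h = T / N`, let `p` be the polynomial of the nonlinearity, and split
the `n`-th state as `u_n + v_n` into its mean `u_n = ⟨e_0, Y_n⟩` and its fluctuation `v_n`. The
operators `S_N` preserve the mean and are bounded on `H` uniformly in `N`
(`exists_smoothing_restrict`), and `P_N S_N` sees only the Fourier modes `|k| ≤ N` of the noise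
(`galerkin_comp_eq`). As long as `|v_n| ≤ |u_n|` pointwise, `p(u_n + v_n)` differs from `p(u_n)` by
at most `K |u_n|^(q-1) |v_n|`. Hence the mean essentially follows `u ↦ h p(u)`, which has size
`h |a_q| |u|^q`, and the relative fluctuation `‖v_n‖ / |u_n|` grows per step at most by a constant
factor `A` that does not depend on `N` (`mean_fluctuation_step`). For odd `q` the mean of `Y_n^q` can
vanish through cancellation, so the relative fluctuation has to be kept small along the whole path;
the bounded growth factor makes this possible at the price of an initial smallness `ε = (2A)^(-N)`.

Accordingly the relevant event asks that the first increment replaces the deterministic initial state,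
up to `ε` in each mode, by a constant of size `κ N`, and that all modes of all later increments are at
most `ε`. On this event `‖Y_N‖ ≥ 2^(2^(N-1))` (`scheme_doubly_exponential`). The `N (2N + 1)` modes
of the increments are independent with law `N(0, h)` (`measure_grid_coeff_mem`) and their prescribed
values are of polynomial size, so the event has probability at least `exp(-c N^(2q+3))`
(`le_measure_grid_coeff_close`, `exp_neg_pow_le`). The doubly exponential size wins against this
(`tendsto_two_pow_sub_pow`).
-/

/-! ### Growth of the mean and of the relative fluctuation -/

/-- One step of the recursion: `x`, `y` are the absolute values of two successive means and `r`, `s`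
bound the corresponding fluctuations. The mean is essentially raised to the power `q`, while the
ratio of fluctuation and mean grows at most by the constant factor `A`. -/
theorem mean_fluctuation_step {q : ℕ} (hq : 2 ≤ q) {α K C h σ ε A R x y r s px δ : ℝ}
    (hα : 0 < α) (hK : 0 ≤ K) (hC : 0 ≤ C) (hh : 0 < h) (hε : 0 ≤ ε) (hε1 : ε ≤ 1)
    (hA : 1 + C * (1 + 2 * K / α) ≤ A) (hR1 : 1 ≤ R) (hhR : 8 ≤ h * α * R) (hCR : C * σ ≤ R)
    (hδ0 : ε ≤ δ) (hKδ : K * δ ≤ α / 4) (hx : R ≤ x) (hr : r ≤ δ * x)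
    (hp : α * x ^ q ≤ px)
    (hy : h * px - x - h * (K * x ^ (q - 1) * r) - ε ≤ y)
    (hs : s ≤ C * (r + h * (K * x ^ (q - 1) * r) + σ * ε)) :
    R ≤ y ∧ s ≤ δ * A * y ∧ (h * α / 2 * x) ^ 2 ≤ h * α / 2 * y := by
  have hx1 : 1 ≤ x := hR1.trans hx
  have hx0 : 0 ≤ x := by linarith
  obtain ⟨X, hX, hXx, hXq⟩ : ∃ X, X = x ^ (q - 1) ∧ x ≤ X ∧ x ^ q = X * x := by
    refine ⟨_, rfl, ?_, ?_⟩
    · exact le_self_pow₀ hx1 (by omega)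
    · rw [← pow_succ]; congr 1; omega
  rw [← hX] at hy hs
  rw [hXq] at hp
  have hX0 : 0 ≤ X := hx0.trans hXx
  have hhα : 0 < h * α := mul_pos hh hα
  have h8 : 8 ≤ h * α * X := hhR.trans (mul_le_mul_of_nonneg_left (hx.trans hXx) hhα.le)
  have hKr : K * X * r ≤ α / 4 * (X * x) := by
    calc K * X * r ≤ K * X * (δ * x) := mul_le_mul_of_nonneg_left hr (mul_nonneg hK hX0)
      _ = K * δ * (X * x) := by ring
      _ ≤ _ := mul_le_mul_of_nonneg_right hKδ (mul_nonneg hX0 hx0)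
  have hhKr := mul_le_mul_of_nonneg_left hKr hh.le
  have hhp := mul_le_mul_of_nonneg_left hp hh.le
  have h8x := mul_le_mul_of_nonneg_right h8 hx0
  have hyq : h * α / 2 * (X * x) ≤ y := by nlinarith
  have hy4 : 4 * x ≤ y := by nlinarith
  have hδ : 0 ≤ δ := hε.trans hδ0
  have hy0 : 0 ≤ y := by linarith
  refine ⟨by linarith, ?_, ?_⟩
  · have h1 : C * (h * (K * X * r)) ≤ C * (2 * K / α) * (δ * y) := by
      have e1 : h * (K * X * r) ≤ 2 * K / α * (δ * y) := by
        calc h * (K * X * r) ≤ h * (K * X * (δ * x)) := by gcongr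
          _ = 2 * K / α * (δ * (h * α / 2 * (X * x))) := by field_simp
          _ ≤ _ := by gcongr
      rw [mul_assoc C]
      exact mul_le_mul_of_nonneg_left e1 hC
    have h2 : C * r ≤ C * (δ * y) := by
      refine mul_le_mul_of_nonneg_left (hr.trans ?_) hC
      exact mul_le_mul_of_nonneg_left (by linarith) hδ
    have h3 : C * (σ * ε) ≤ δ * y := by
      calc C * (σ * ε) = (C * σ) * ε := by ring
        _ ≤ y * δ := mul_le_mul (by linarith) hδ0 hε hy0
        _ = _ := mul_comm _ _
    have h4 : (1 + C * (1 + 2 * K / α)) * (δ * y) ≤ A * (δ * y) :=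
      mul_le_mul_of_nonneg_right hA (mul_nonneg hδ hy0)
    nlinarith
  · have e1 : (h * α / 2 * x) ^ 2 ≤ h * α / 2 * (h * α / 2 * (X * x)) := by
      have := mul_le_mul_of_nonneg_right hXx hx0
      have h2 := mul_le_mul_of_nonneg_left this (mul_nonneg hhα.le hhα.le)
      nlinarith
    exact e1.trans (mul_le_mul_of_nonneg_left hyq (by linarith))

/-- Doubly exponential growth of the mean along the recursion of `mean_fluctuation_step`. -/
theorem mean_doubly_exponential {q : ℕ} (hq : 2 ≤ q) {α K C h σ ε A R : ℝ} {N : ℕ}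
    (hα : 0 < α) (hK : 0 ≤ K) (hC : 0 ≤ C) (hh : 0 < h) (hσ : 0 ≤ σ) (hε : 0 ≤ ε) (hε1 : ε ≤ 1)
    (hA : 1 + C * (1 + 2 * K / α) ≤ A) (hR1 : 1 ≤ R) (hhR : 8 ≤ h * α * R) (hCR : C * σ ≤ R)
    (hσε : σ * (ε * A ^ N) ≤ 1) (hKε : K * (ε * A ^ N) ≤ α / 4)
    {p : ℝ → ℝ} (hp : ∀ u, R ≤ |u| → α * |u| ^ q ≤ |p u|) {u r : ℕ → ℝ}
    (hu : ∀ n, 1 ≤ n → n < N → R ≤ |u n| → σ * r n ≤ |u n| →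
      h * |p (u n)| - |u n| - h * (K * |u n| ^ (q - 1) * r n) - ε ≤ |u (n + 1)|)
    (hr : ∀ n, 1 ≤ n → n < N → R ≤ |u n| → σ * r n ≤ |u n| →
      r (n + 1) ≤ C * (r n + h * (K * |u n| ^ (q - 1) * r n) + σ * ε))
    (hu1 : R ≤ |u 1|) (hr1 : r 1 ≤ ε * |u 1|) (n : ℕ) (hn : 1 ≤ n) (hnN : n ≤ N) :
    R ≤ |u n| ∧ r n ≤ ε * A ^ n * |u n| ∧ (2 : ℝ) ^ 2 ^ (n - 1) ≤ h * α / 2 * |u n| := by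
  have hA1 : 1 ≤ A := by
    have : 0 ≤ C * (1 + 2 * K / α) := by positivity
    linarith
  have hA0 : 0 ≤ A := by linarith
  induction n, hn using Nat.le_induction with
  | base =>
    refine ⟨hu1, hr1.trans ?_, ?_⟩
    · rw [pow_one]
      exact mul_le_mul_of_nonneg_right (le_mul_of_one_le_right hε hA1) (abs_nonneg _)
    · have := mul_le_mul_of_nonneg_left hu1 (mul_pos hh hα).le
      norm_num
      linarith
  | succ n hn ih =>
    obtain ⟨hR, hrn, hg⟩ := ih (by omega)
    have hpow : A ^ n ≤ A ^ N := pow_le_pow_right₀ hA1 (by omega)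
    have hle : ε * A ^ n ≤ ε * A ^ N := mul_le_mul_of_nonneg_left hpow hε
    have hσr : σ * r n ≤ |u n| := by
      calc σ * r n ≤ σ * (ε * A ^ N * |u n|) := by
            refine mul_le_mul_of_nonneg_left (hrn.trans ?_) hσ
            exact mul_le_mul_of_nonneg_right hle (abs_nonneg _)
        _ = σ * (ε * A ^ N) * |u n| := by ring
        _ ≤ 1 * |u n| := mul_le_mul_of_nonneg_right hσε (abs_nonneg _)
        _ = _ := one_mul _
    obtain ⟨h1, h2, h3⟩ := mean_fluctuation_step hq hα hK hC hh hε hε1 hA hR1 hhR hCR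
      (le_mul_of_one_le_right hε (one_le_pow₀ hA1))
      ((mul_le_mul_of_nonneg_left hle hK).trans hKε) hR hrn (hp _ hR)
      (hu n hn (by omega) hR hσr) (hr n hn (by omega) hR hσr)
    refine ⟨h1, ?_, le_trans ?_ h3⟩
    · rwa [pow_succ, ← mul_assoc]
    · calc (2 : ℝ) ^ 2 ^ (n + 1 - 1) = ((2 : ℝ) ^ 2 ^ (n - 1)) ^ 2 := by
            rw [← pow_mul, ← pow_succ]; congr 2; omega
        _ ≤ _ := pow_le_pow_left₀ (by positivity) hg 2

/-! ### Lower bounds for Gaussian probabilities -/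

/-- The density at the point of the interval farthest from `0` bounds the mass of the interval. -/
theorem le_gaussianReal_Icc {v : ℝ≥0} (hv : v ≠ 0) (m ε : ℝ) :
    ENNReal.ofReal (2 * ε * ((√(2 * Real.pi * v))⁻¹ * Real.exp (-(|m| + ε) ^ 2 / (2 * v)))) ≤
      gaussianReal 0 v (Icc (m - ε) (m + ε)) := by
  rw [gaussianReal_apply _ hv]
  have h1 : ∀ x ∈ Icc (m - ε) (m + ε),
      ENNReal.ofReal ((√(2 * Real.pi * v))⁻¹ * Real.exp (-(|m| + ε) ^ 2 / (2 * v))) ≤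
        gaussianPDF 0 v x := by
    intro x hx
    rw [gaussianPDF, gaussianPDFReal, sub_zero]
    refine ENNReal.ofReal_le_ofReal ?_
    have hxm : |x| ≤ |m| + ε := by
      rw [abs_le]
      constructor
      · linarith [hx.1, neg_abs_le m]
      · linarith [hx.2, le_abs_self m]
    have hsq : x ^ 2 ≤ (|m| + ε) ^ 2 := by
      rw [← sq_abs x]; exact pow_le_pow_left₀ (abs_nonneg _) hxm 2
    gcongr
  calc _ = ENNReal.ofReal ((√(2 * Real.pi * v))⁻¹ * Real.exp (-(|m| + ε) ^ 2 / (2 * v))) *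
        volume (Icc (m - ε) (m + ε)) := by
        rw [Real.volume_Icc, ← ENNReal.ofReal_mul (by positivity)]
        congr 1; ring
    _ ≤ _ := by
        rw [← setLIntegral_const]
        exact setLIntegral_mono' measurableSet_Icc h1

/-- Random variables all of whose linear combinations `∑ cᵢ Xᵢ` have the law `N(0, v ∑ cᵢ²)` are
independent. -/
theorem iIndepFun_of_linearCombination_gaussian {Ω ι : Type*} [Fintype ι] [MeasurableSpace Ω]
    {P : Measure Ω} [IsProbabilityMeasure P] {X : ι → Ω → ℝ} {v : ℝ≥0}
    (hX : ∀ i, AEMeasurable (X i) P)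
    (h : ∀ c : ι → ℝ, P.map (fun ω => ∑ i, c i * X i ω) =
      gaussianReal 0 (v * (∑ i, c i ^ 2).toNNReal)) :
    iIndepFun X P := by
  classical
  have hmarg : ∀ i, P.map (X i) = gaussianReal 0 v := by
    intro i
    have := h (Pi.single i 1)
    simpa [Pi.single_apply, Finset.sum_ite_eq, ite_pow] using this
  rw [iIndepFun_iff_charFun_pi hX]
  intro t
  have hm : AEMeasurable (fun ω => WithLp.toLp 2 (fun i => X i ω)) P := by fun_prop
  have hL : charFun (P.map (fun ω => WithLp.toLp 2 (fun i => X i ω))) t =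
      charFun (P.map (fun ω => ∑ i, t i * X i ω)) 1 := by
    rw [charFun_apply, charFun_apply_real, integral_map hm (by fun_prop),
      integral_map (by fun_prop) (by fun_prop)]
    congr 1; ext ω
    simp [PiLp.inner_apply]
  rw [hL, h]
  simp_rw [hmarg, charFun_gaussianReal]
  rw [← Complex.exp_sum]
  congr 1
  have h0 : 0 ≤ ∑ i, t i ^ 2 := Finset.sum_nonneg fun i _ => sq_nonneg _
  simp only [NNReal.coe_mul, Real.coe_toNNReal _ h0]
  push_cast
  simp [Finset.sum_div, Finset.mul_sum]

/-! ### The polynomial and its nonlinear operator -/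

/-- The scalar polynomial `y ↦ ∑_{k ≤ q} a_k y^k`. -/
def coeffPoly (q : ℕ) (a : ℕ → ℝ) (y : ℝ) : ℝ := ∑ k ∈ Finset.range (q + 1), a k * y ^ k

/-- The local Lipschitz estimate that linearizes the polynomial around a dominating mean `u`. -/
theorem exists_abs_coeffPoly_sub_le (q : ℕ) (a : ℕ → ℝ) :
    ∃ K : ℝ, 0 ≤ K ∧ ∀ u v : ℝ, 1 ≤ |u| → |v| ≤ |u| →
      |coeffPoly q a (u + v) - coeffPoly q a u| ≤ K * |u| ^ (q - 1) * |v| := by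
  refine ⟨∑ k ∈ Finset.range (q + 1), |a k| * (k * 2 ^ (k - 1)),
    Finset.sum_nonneg fun k _ => by positivity, fun u v hu hv => ?_⟩
  rw [coeffPoly, coeffPoly, ← Finset.sum_sub_distrib, Finset.sum_mul, Finset.sum_mul]
  refine (Finset.abs_sum_le_sum_abs _ _).trans (Finset.sum_le_sum fun k hk => ?_)
  have hkq : k ≤ q := Nat.lt_succ_iff.1 (Finset.mem_range.1 hk)
  rw [← mul_sub, abs_mul, mul_assoc, mul_assoc]
  refine mul_le_mul_of_nonneg_left ?_ (abs_nonneg _)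
  have h1 := abs_pow_sub_pow_le (u + v) u k
  rw [add_sub_cancel_left] at h1
  refine h1.trans ?_
  have h2 : max |u + v| |u| ≤ 2 * |u| :=
    max_le ((abs_add_le u v).trans (by linarith)) (by linarith [abs_nonneg u])
  have h3 : max |u + v| |u| ^ (k - 1) ≤ 2 ^ (k - 1) * |u| ^ (q - 1) := by
    calc max |u + v| |u| ^ (k - 1) ≤ (2 * |u|) ^ (k - 1) :=
          pow_le_pow_left₀ (le_max_of_le_right (abs_nonneg _)) h2 _
      _ = 2 ^ (k - 1) * |u| ^ (k - 1) := mul_pow _ _ _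
      _ ≤ _ := by
        gcongr
  calc |v| * k * max |u + v| |u| ^ (k - 1) ≤ |v| * k * (2 ^ (k - 1) * |u| ^ (q - 1)) := by gcongr
    _ = _ := by ring

theorem exists_le_abs_coeffPoly {q : ℕ} (hq : 1 ≤ q) (a : ℕ → ℝ) (ha : a q ≠ 0) :
    ∃ R : ℝ, ∀ u : ℝ, R ≤ |u| → |a q| / 2 * |u| ^ q ≤ |coeffPoly q a u| := by
  have haq : 0 < |a q| := abs_pos.2 ha
  set B := ∑ k ∈ Finset.range q, |a k| with hB
  have hB0 : 0 ≤ B := Finset.sum_nonneg fun k _ => abs_nonneg _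
  refine ⟨1 + 2 * B / |a q|, fun u hu => ?_⟩
  have hd : 0 ≤ 2 * B / |a q| := by positivity
  have hu1 : 1 ≤ |u| := by linarith
  have hBu : B ≤ |a q| / 2 * |u| := by
    have : 2 * B / |a q| ≤ |u| := by linarith
    rw [div_le_iff₀ haq] at this
    linarith
  have hlow : |∑ k ∈ Finset.range q, a k * u ^ k| ≤ B * |u| ^ (q - 1) := by
    rw [hB, Finset.sum_mul]
    refine (Finset.abs_sum_le_sum_abs _ _).trans (Finset.sum_le_sum fun k hk => ?_)
    rw [abs_mul, abs_pow]
    have hkq := Finset.mem_range.1 hk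
    gcongr
    · omega
  -- the lower order terms are at most half of the leading one
  have hlow' : B * |u| ^ (q - 1) ≤ |a q| / 2 * |u| ^ q := by
    calc B * |u| ^ (q - 1) ≤ |a q| / 2 * |u| * |u| ^ (q - 1) := by gcongr
      _ = |a q| / 2 * |u| ^ (q - 1 + 1) := by ring
      _ = _ := by congr 2; omega
  rw [coeffPoly, Finset.sum_range_succ]
  have h := abs_sub_abs_le_abs_sub (a q * u ^ q) (-∑ k ∈ Finset.range q, a k * u ^ k)
  rw [abs_neg, sub_neg_eq_add, abs_mul, abs_pow, add_comm (a q * u ^ q)] at h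
  linarith

theorem coeFn_polyNonlin (q : ℕ) (a : ℕ → ℝ) {v : H} (hv : v ∈ Submodule.span ℝ (Set.range e)) :
    polyNonlin q a v =ᵐ[unitMeasure] fun x => coeffPoly q a (v x) := by
  rw [polyNonlin, dif_pos (memLp_polyFun q a v hv)]
  exact MemLp.coeFn_toLp _

theorem coeFn_smul_e_zero (c : ℝ) : (c • e 0 : H) =ᵐ[unitMeasure] fun _ => c := by
  filter_upwards [Lp.coeFn_smul c (e 0), (memLp_trigFun 0).coeFn_toLp] with x h1 h2
  rw [h1, Pi.smul_apply, e, h2]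
  simp [trigFun]

theorem norm_e (n : ℤ) : ‖e n‖ = 1 := orthonormal_e.1 n

/-- If `v` is a function with small oscillation around the constant `u`, then the polynomial maps
`v` to a function with small oscillation around the constant `p(u)`. -/
theorem norm_polyNonlin_sub_le {q : ℕ} {a : ℕ → ℝ} {v : H}
    (hv : v ∈ Submodule.span ℝ (Set.range e)) {u L : ℝ}
    (h : ∀ᵐ x ∂unitMeasure, |coeffPoly q a (u + (v - u • e 0 : H) x) - coeffPoly q a u| ≤
      L * |(v - u • e 0 : H) x|) :
    ‖polyNonlin q a v - coeffPoly q a u • e 0‖ ≤ L * ‖v - u • e 0‖ := by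
  refine Lp.norm_le_mul_norm_of_ae_le_mul ?_
  filter_upwards [h, coeFn_polyNonlin q a hv, coeFn_smul_e_zero u,
    coeFn_smul_e_zero (coeffPoly q a u), Lp.coeFn_sub v (u • e 0),
    Lp.coeFn_sub (polyNonlin q a v) (coeffPoly q a u • e 0)] with x h1 h2 h3 h4 h5 h6
  rw [h6, Pi.sub_apply, h2, h4, Real.norm_eq_abs, Real.norm_eq_abs]
  rw [h5, Pi.sub_apply, h3, add_sub_cancel] at h1
  rw [h5, Pi.sub_apply, h3]
  exact h1

/-! ### Fourier truncations -/

/-- The truncation `v ↦ ∑_{n ∈ F} ⟨e_n, v⟩ e_n` of the Fourier series of `v` to the modes in `F`. -/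
noncomputable def fourierTrunc (F : Finset ℤ) : H →ₗ[ℝ] H where
  toFun v := ∑ n ∈ F, ⟪e n, v⟫ • e n
  map_add' v w := by simp only [inner_add_right, add_smul, Finset.sum_add_distrib]
  map_smul' c v := by
    simp only [inner_smul_right, mul_smul, ← Finset.smul_sum, RingHom.id_apply]

theorem fourierTrunc_apply (F : Finset ℤ) (v : H) :
    fourierTrunc F v = ∑ n ∈ F, ⟪e n, v⟫ • e n := rfl

theorem ext_inner_e {v w : H} (h : ∀ n, ⟪e n, v⟫ = ⟪e n, w⟫) : v = w :=
  sub_eq_zero.1 (eq_zero_of_inner_e_eq_zero _ fun n => by rw [inner_sub_right, h, sub_self])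

theorem inner_e_sum_smul (F : Finset ℤ) (c : ℤ → ℝ) (n : ℤ) :
    ⟪e n, ∑ k ∈ F, c k • e k⟫ = if n ∈ F then c n else 0 := by
  rw [inner_sum]
  simp [inner_smul_right, orthonormal_iff_ite.1 orthonormal_e]

theorem inner_e_fourierTrunc (F : Finset ℤ) (v : H) (n : ℤ) :
    ⟪e n, fourierTrunc F v⟫ = if n ∈ F then ⟪e n, v⟫ else 0 :=
  inner_e_sum_smul F _ n

theorem norm_fourierTrunc_le (F : Finset ℤ) (v : H) : ‖fourierTrunc F v‖ ≤ ‖v‖ := by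
  refine (sq_le_sq₀ (norm_nonneg _) (norm_nonneg _)).1 ?_
  rw [← real_inner_self_eq_norm_sq, fourierTrunc_apply, orthonormal_e.inner_sum]
  refine le_trans (le_of_eq ?_) (orthonormal_e.sum_inner_products_le v (s := F))
  refine Finset.sum_congr rfl fun n _ => ?_
  simp [pow_two]

theorem fourierTrunc_mem_span (F : Finset ℤ) (v : H) :
    fourierTrunc F v ∈ Submodule.span ℝ (Set.range e) :=
  Submodule.sum_mem _ fun n _ => Submodule.smul_mem _ _ (Submodule.subset_span ⟨n, rfl⟩)

theorem norm_sum_smul_e_le (F : Finset ℤ) (c : ℤ → ℝ) {ε : ℝ} (h : ∀ n ∈ F, |c n| ≤ ε) :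
    ‖∑ n ∈ F, c n • e n‖ ≤ F.card * ε := by
  refine (norm_sum_le _ _).trans ?_
  rw [← nsmul_eq_mul]
  refine Finset.sum_le_card_nsmul _ _ _ fun n hn => ?_
  rw [norm_smul, norm_e, mul_one]
  exact h n hn

theorem abs_inner_e_le (n : ℤ) (v : H) : |⟪e n, v⟫| ≤ ‖v‖ := by
  have := abs_real_inner_le_norm (e n) v
  rwa [norm_e, one_mul] at this

/-- An inverse inequality: on trigonometric polynomials the supremum norm is controlled by the
`L²` norm. -/
theorem abs_fourierTrunc_le (F : Finset ℤ) (v : H) :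
    ∀ᵐ x ∂unitMeasure, |fourierTrunc F v x| ≤ 2 * F.card * ‖v‖ := by
  have h : ∀ c : ℤ → ℝ, ∀ᵐ x ∂unitMeasure,
      |(∑ n ∈ F, c n • e n : H) x| ≤ ∑ n ∈ F, |c n| * √2 := by
    intro c
    induction F using Finset.induction_on with
    | empty =>
      filter_upwards [Lp.coeFn_zero ℝ 2 unitMeasure] with x hx
      rw [Finset.sum_empty, hx]
      simp
    | insert n F hn ih =>
      rw [Finset.sum_insert hn, Finset.sum_insert hn]
      filter_upwards [ih, Lp.coeFn_add (c n • e n) (∑ n ∈ F, c n • e n),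
        Lp.coeFn_smul (c n) (e n), (memLp_trigFun n).coeFn_toLp] with x h1 h2 h3 h4
      rw [h2, Pi.add_apply, h3, Pi.smul_apply, e, h4, smul_eq_mul]
      refine (abs_add_le _ _).trans (add_le_add ?_ h1)
      rw [abs_mul]
      exact mul_le_mul_of_nonneg_left (abs_trigFun_le n x) (abs_nonneg _)
  have hs : √2 ≤ 2 := Real.sqrt_le_iff.2 (by norm_num)
  filter_upwards [h fun n => ⟪e n, v⟫] with x hx
  refine hx.trans ?_
  calc ∑ n ∈ F, |⟪e n, v⟫| * √2 ≤ ∑ n ∈ F, ‖v‖ * 2 :=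
        Finset.sum_le_sum fun n _ =>
          mul_le_mul (abs_inner_e_le n v) hs (by positivity) (norm_nonneg _)
    _ = _ := by rw [Finset.sum_const, nsmul_eq_mul]; ring

/-- A trigonometric polynomial of mean `u` and oscillation at most `|u|` is mapped by the polynomial
nonlinearity to a function close to the constant `p(u)`. -/
theorem norm_polyNonlin_fourierTrunc_sub_le {q : ℕ} {a : ℕ → ℝ} {K : ℝ}
    (hK : ∀ u v : ℝ, 1 ≤ |u| → |v| ≤ |u| →
      |coeffPoly q a (u + v) - coeffPoly q a u| ≤ K * |u| ^ (q - 1) * |v|)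
    {F : Finset ℤ} (h0 : 0 ∈ F) {v : H} (hv : fourierTrunc F v = v) {u : ℝ} (hu : 1 ≤ |u|)
    (h : 2 * F.card * ‖v - u • e 0‖ ≤ |u|) :
    ‖polyNonlin q a v - coeffPoly q a u • e 0‖ ≤ K * |u| ^ (q - 1) * ‖v - u • e 0‖ := by
  have hvs : v ∈ Submodule.span ℝ (Set.range e) := hv ▸ fourierTrunc_mem_span F v
  have hw : fourierTrunc F (v - u • e 0) = v - u • e 0 := by
    rw [map_sub, map_smul, hv]
    congr 2
    refine ext_inner_e fun n => ?_
    rw [inner_e_fourierTrunc, orthonormal_iff_ite.1 orthonormal_e]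
    split_ifs <;> simp_all
  refine norm_polyNonlin_sub_le hvs ?_
  have := abs_fourierTrunc_le F (v - u • e 0)
  rw [hw] at this
  filter_upwards [this] with x hx
  exact hK _ _ hu (hx.trans h)

theorem norm_polyNonlin_le {q : ℕ} (a : ℕ → ℝ) {F : Finset ℤ} {v : H}
    (hv : fourierTrunc F v = v) :
    ‖polyNonlin q a v‖ ≤ ∑ k ∈ Finset.range (q + 1), |a k| * (2 * F.card * ‖v‖) ^ k := by
  have hvs : v ∈ Submodule.span ℝ (Set.range e) := hv ▸ fourierTrunc_mem_span F v
  have hsup := abs_fourierTrunc_le F v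
  rw [hv] at hsup
  have h0 : 0 ≤ ∑ k ∈ Finset.range (q + 1), |a k| * (2 * F.card * ‖v‖) ^ k :=
    Finset.sum_nonneg fun k _ => by positivity
  have : ‖polyNonlin q a v‖ ≤
      (∑ k ∈ Finset.range (q + 1), |a k| * (2 * F.card * ‖v‖) ^ k) * ‖(1 : ℝ) • e 0‖ := by
    refine Lp.norm_le_mul_norm_of_ae_le_mul ?_
    filter_upwards [hsup, coeFn_polyNonlin q a hvs, coeFn_smul_e_zero 1] with x h1 h2 h3
    rw [h2, h3, norm_one, mul_one, coeffPoly]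
    refine (norm_sum_le _ _).trans (Finset.sum_le_sum fun k _ => ?_)
    rw [norm_mul, norm_pow, Real.norm_eq_abs, Real.norm_eq_abs]
    gcongr
  simpa [norm_e] using this

/-! ### Reduction of the numerical scheme to `H` -/

section Reduction

variable {η : ℝ} [Fact (0 < η)] {ν : ℝ}

theorem coeff_galerkin {r s : ℝ} (N : ℕ) (u : InterpSpace η r) (k : ℤ) :
    (InterpSpace.galerkin η r s N u).coeff k =
      if k ∈ Finset.Icc (-(N : ℤ)) N then u.coeff k else 0 := by
  have h : ∀ x : InterpSpace η s, x.coeff k = InterpSpace.coeffCLM η s k x := fun _ => rfl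
  rw [InterpSpace.galerkin_apply, h, map_sum]
  simp_rw [map_smul, ← h, InterpSpace.coeff_basisVec]
  simp

theorem ofL2_injective {r : ℝ} (hr : r ≤ 0) :
    Function.Injective (InterpSpace.ofL2 η hr) := fun v w h =>
  ext_inner_e fun n => by rw [← InterpSpace.coeff_ofL2 (η := η) hr, h, InterpSpace.coeff_ofL2]

/-- An operator of `H_{-ν}` with values in `H_{1-ν} ⊆ H` restricts to a linear operator of `H`. -/
theorem exists_restrict_L2 (hν0 : -ν ≤ 0) (hν1 : ν ≤ 1)
    (B : InterpSpace η (-ν) →L[ℝ] InterpSpace η (-ν))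
    (hB : ∀ u : InterpSpace η (-ν), ∃ z : InterpSpace η (-ν + 1),
      InterpSpace.incl (le_add_of_le_of_nonneg le_rfl zero_le_one) z = B u) :
    ∃ L : H →ₗ[ℝ] H, ∀ w, InterpSpace.ofL2 η hν0 (L w) = B (InterpSpace.ofL2 η hν0 w) := by
  have h : ∀ w : H, ∃ z : H, InterpSpace.ofL2 η hν0 z = B (InterpSpace.ofL2 η hν0 w) := by
    intro w
    obtain ⟨z, hz⟩ := hB (InterpSpace.ofL2 η hν0 w)
    refine ⟨InterpSpace.equivL2 η (InterpSpace.incl (by linarith) z), ?_⟩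
    rw [← hz]
    ext n
    rw [InterpSpace.coeff_ofL2, InterpSpace.inner_e_equivL2, InterpSpace.coeff_incl,
      InterpSpace.coeff_incl]
  choose L hL using h
  refine ⟨⟨⟨L, fun v w => ?_⟩, fun c v => ?_⟩, hL⟩
  · apply ofL2_injective (η := η) hν0
    rw [map_add, hL, hL, hL, map_add, map_add]
  · apply ofL2_injective (η := η) hν0
    rw [RingHom.id_apply, map_smul, hL, hL, map_smul, map_smul]

/-- An operator of `H_{-ν}` commuting with the Galerkin projection on the dense subspace `H` commutes
with it everywhere; so the projected operator only sees the Fourier modes up to `N`. -/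
theorem galerkin_comp_eq (hν0 : -ν ≤ 0) (N : ℕ)
    (B : InterpSpace η (-ν) →L[ℝ] InterpSpace η (-ν)) {L : H →ₗ[ℝ] H}
    (hL : ∀ w, InterpSpace.ofL2 η hν0 (L w) = B (InterpSpace.ofL2 η hν0 w))
    (hproj : ∀ v : H, InterpSpace.galerkin η (-ν) (-ν) N (B (InterpSpace.ofL2 η hν0 v)) =
      B (InterpSpace.galerkin η (-ν) (-ν) N (InterpSpace.ofL2 η hν0 v)))
    (x : InterpSpace η (-ν)) :
    InterpSpace.equivL2 η (InterpSpace.galerkin η (-ν) 0 N (B x)) =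
      L (∑ k ∈ Finset.Icc (-(N : ℤ)) N, x.coeff k • e k) := by
  have hcomm : InterpSpace.galerkin η (-ν) (-ν) N (B x) =
      B (InterpSpace.galerkin η (-ν) (-ν) N x) := by
    refine congrFun ((InterpSpace.denseRange_ofL2 (η := η) hν0).equalizer
      (g := fun x => InterpSpace.galerkin η (-ν) (-ν) N (B x))
      (h := fun x => B (InterpSpace.galerkin η (-ν) (-ν) N x)) (by fun_prop) (by fun_prop) ?_) x
    ext1 v
    exact hproj v
  apply ofL2_injective (η := η) hν0
  have h2 : InterpSpace.ofL2 η hν0 (∑ k ∈ Finset.Icc (-(N : ℤ)) N, x.coeff k • e k) =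
      InterpSpace.galerkin η (-ν) (-ν) N x := by
    ext n
    rw [InterpSpace.coeff_ofL2, inner_e_sum_smul, coeff_galerkin]
  rw [hL, h2, ← hcomm]
  ext n
  rw [InterpSpace.coeff_ofL2, InterpSpace.inner_e_equivL2, coeff_galerkin, coeff_galerkin]

theorem fourierTrunc_equivL2_galerkin {r : ℝ} (N : ℕ) (x : InterpSpace η r) :
    fourierTrunc (Finset.Icc (-(N : ℤ)) N)
      (InterpSpace.equivL2 η (InterpSpace.galerkin η r 0 N x)) =
      InterpSpace.equivL2 η (InterpSpace.galerkin η r 0 N x) := by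
  refine ext_inner_e fun n => ?_
  rw [inner_e_fourierTrunc, InterpSpace.inner_e_equivL2, coeff_galerkin]
  split_ifs <;> rfl

theorem norm_equivL2_galerkin_le {r : ℝ} (hr : 0 ≤ r) (N : ℕ) (x : InterpSpace η r) :
    ‖InterpSpace.equivL2 η (InterpSpace.galerkin η r 0 N x)‖ ≤
      ‖(InterpSpace.incl hr x : InterpSpace η 0)‖ := by
  have h : InterpSpace.equivL2 η (InterpSpace.galerkin η r 0 N x) =
      fourierTrunc (Finset.Icc (-(N : ℤ)) N)
        (InterpSpace.equivL2 η (InterpSpace.incl hr x)) := by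
    refine ext_inner_e fun n => ?_
    rw [inner_e_fourierTrunc, InterpSpace.inner_e_equivL2, InterpSpace.inner_e_equivL2,
      coeff_galerkin, InterpSpace.coeff_incl]
  rw [h]
  refine (norm_fourierTrunc_le _ _).trans ?_
  rw [LinearIsometryEquiv.norm_map]

end Reduction

/-! ### Pathwise explosion on a small event -/

/-- A linear operator `L` which preserves the mean and the constants acts on the fluctuation. -/
theorem map_sum_sub_mean {L : H →ₗ[ℝ] H} (hL0 : L (e 0) = e 0)
    (hLm : ∀ w, ⟪e 0, L w⟫ = ⟪e 0, w⟫) {F : Finset ℤ} (h0 : 0 ∈ F) (d : ℤ → ℝ) :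
    L (∑ k ∈ F, d k • e k) - ⟪e 0, L (∑ k ∈ F, d k • e k)⟫ • e 0 =
      L (∑ k ∈ F.erase 0, d k • e k) := by
  rw [hLm, inner_e_sum_smul, if_pos h0, ← Finset.add_sum_erase F _ h0, map_add, map_smul, hL0,
    add_sub_cancel_left]

/-- If the first increment essentially replaces the current state by the constant `R + 1`, and if
the Fourier modes of all further increments are tiny, then the scheme explodes. Here `L` is the
smoothing operator, `h` the step size, and `g n k` the `k`-th Fourier mode of the `n`-th
increment. -/
theorem scheme_doubly_exponential {q : ℕ} (hq : 2 ≤ q) {a : ℕ → ℝ} {α K C h ε A R : ℝ} {N : ℕ}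
    (hα : 0 < α) (hK0 : 0 ≤ K) (hC : 0 ≤ C) (hh : 0 < h) (hε : 0 ≤ ε) (hε1 : ε ≤ 1)
    {F : Finset ℤ} (h0 : 0 ∈ F)
    (hA : 1 + C * (1 + 2 * K / α) ≤ A) (hR1 : 1 ≤ R) (hhR : 8 ≤ h * α * R)
    (hCR : C * (2 * F.card) ≤ R)
    (hσε : 2 * F.card * (ε * A ^ N) ≤ 1) (hKε : K * (ε * A ^ N) ≤ α / 4)
    (hp : ∀ u, R ≤ |u| → α * |u| ^ q ≤ |coeffPoly q a u|)
    (hK : ∀ u v : ℝ, 1 ≤ |u| → |v| ≤ |u| →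
      |coeffPoly q a (u + v) - coeffPoly q a u| ≤ K * |u| ^ (q - 1) * |v|)
    {L : H →ₗ[ℝ] H} (hL0 : L (e 0) = e 0) (hLm : ∀ w, ⟪e 0, L w⟫ = ⟪e 0, w⟫)
    (hLC : ∀ w, ‖L w‖ ≤ C * ‖w‖) {Y : ℕ → H} {g : ℕ → ℤ → ℝ}
    (hYF : ∀ n ≤ N, fourierTrunc F (Y n) = Y n)
    (hstep : ∀ n < N, Y (n + 1) =
      L (∑ k ∈ F, (⟪e k, Y n + h • polyNonlin q a (Y n)⟫ + g n k) • e k))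
    (hg0 : ∀ k ∈ F, |g 0 k - ((if k = 0 then R + 1 else 0) -
      ⟪e k, Y 0 + h • polyNonlin q a (Y 0)⟫)| ≤ ε)
    (hg : ∀ n, 1 ≤ n → n < N → ∀ k ∈ F, |g n k| ≤ ε) (hN : 1 ≤ N) :
    (2 : ℝ) ^ 2 ^ (N - 1) ≤ h * α / 2 * ‖Y N‖ := by
  have hcard : ((F.erase 0).card : ℝ) ≤ F.card := by
    exact_mod_cast Finset.card_le_card (Finset.erase_subset _ _)
  have hσ : (0 : ℝ) ≤ 2 * F.card := by positivity
  have hsmall : ∀ n < N, R ≤ |⟪e 0, Y n⟫| →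
      2 * F.card * ‖Y n - ⟪e 0, Y n⟫ • e 0‖ ≤ |⟪e 0, Y n⟫| →
      ‖polyNonlin q a (Y n) - coeffPoly q a ⟪e 0, Y n⟫ • e 0‖ ≤
        K * |⟪e 0, Y n⟫| ^ (q - 1) * ‖Y n - ⟪e 0, Y n⟫ • e 0‖ := fun n hn h1 h2 =>
    norm_polyNonlin_fourierTrunc_sub_le hK h0 (hYF n hn.le) (hR1.trans h1) h2
  have hmean : ∀ n < N, ⟪e 0, Y (n + 1)⟫ =
      ⟪e 0, Y n + h • polyNonlin q a (Y n)⟫ + g n 0 := by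
    intro n hn
    rw [hstep n hn, hLm, inner_e_sum_smul, if_pos h0]
  have hfluct : ∀ n < N, Y (n + 1) - ⟪e 0, Y (n + 1)⟫ • e 0 =
      L (∑ k ∈ F.erase 0, (⟪e k, Y n + h • polyNonlin q a (Y n)⟫ + g n k) • e k) := by
    intro n hn
    rw [hstep n hn, map_sum_sub_mean hL0 hLm h0]
  have hkey := mean_doubly_exponential hq hα hK0 hC hh hσ hε hε1 hA hR1 hhR hCR hσε hKε hp
    (u := fun n => ⟪e 0, Y n⟫) (r := fun n => ‖Y n - ⟪e 0, Y n⟫ • e 0‖) ?_ ?_ ?_ ?_ N hN le_rfl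
  · refine hkey.2.2.trans ?_
    have := abs_inner_e_le 0 (Y N)
    gcongr
  · intro n hn hnN hR hσr
    have hs := (abs_inner_e_le 0 _).trans (hsmall n hnN hR hσr)
    have hgn := hg n hn hnN 0 h0
    rw [inner_sub_right, inner_smul_right, orthonormal_iff_ite.1 orthonormal_e, if_pos rfl,
      mul_one] at hs
    rw [hmean n hnN, inner_add_right, inner_smul_right]
    set u := ⟪e 0, Y n⟫
    set f := ⟪e 0, polyNonlin q a (Y n)⟫
    have e1 : h * |coeffPoly q a u| ≤ |h * f| +
        h * (K * |u| ^ (q - 1) * ‖Y n - u • e 0‖) := by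
      rw [abs_mul, abs_of_pos hh, ← mul_add]
      refine mul_le_mul_of_nonneg_left ?_ hh.le
      have := abs_sub_abs_le_abs_sub (coeffPoly q a u) f
      rw [abs_sub_comm] at this
      linarith
    have e2 : |h * f| ≤ |u + h * f + g n 0| + |u| + |g n 0| := by
      calc |h * f| = |(u + h * f + g n 0) - u - g n 0| := by congr 1; ring
        _ ≤ _ := (abs_sub _ _).trans (by gcongr; exact abs_sub _ _)
    linarith
  · intro n hn hnN hR hσr
    have hs := hsmall n hnN hR hσr
    rw [hfluct n hnN]
    refine (hLC _).trans (mul_le_mul_of_nonneg_left ?_ hC)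
    set u := ⟪e 0, Y n⟫
    -- removing a multiple of `e 0` does not change the nonzero modes
    have e1 : ∑ k ∈ F.erase 0, (⟪e k, Y n + h • polyNonlin q a (Y n)⟫ + g n k) • e k =
        fourierTrunc (F.erase 0) ((Y n - u • e 0) +
          h • (polyNonlin q a (Y n) - coeffPoly q a u • e 0)) +
        ∑ k ∈ F.erase 0, g n k • e k := by
      rw [fourierTrunc_apply, ← Finset.sum_add_distrib]
      refine Finset.sum_congr rfl fun k hk => ?_
      have hk0 := (Finset.mem_erase.1 hk).1
      simp only [inner_add_right, inner_sub_right, inner_smul_right,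
        orthonormal_iff_ite.1 orthonormal_e, if_neg hk0, mul_zero, sub_zero]
      rw [← add_smul]
    rw [e1]
    refine (norm_add_le _ _).trans (add_le_add ?_ ?_)
    · refine (norm_fourierTrunc_le _ _).trans ((norm_add_le _ _).trans ?_)
      rw [norm_smul, Real.norm_of_nonneg hh.le]
      gcongr
    · refine (norm_sum_smul_e_le _ _ fun k hk =>
        hg n hn hnN k (Finset.mem_of_mem_erase hk)).trans ?_
      nlinarith
  · have h1 := hg0 0 h0
    rw [hmean 0 (by omega)]
    rw [if_pos rfl, abs_le] at h1
    refine le_trans ?_ (le_abs_self _)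
    linarith [h1.1]
  · have hge : R ≤ |⟪e 0, Y 1⟫| := by
      have h1 := hg0 0 h0
      rw [hmean 0 (by omega)]
      rw [if_pos rfl, abs_le] at h1
      refine le_trans ?_ (le_abs_self _)
      linarith [h1.1]
    rw [hfluct 0 (by omega)]
    refine (hLC _).trans ?_
    have h2 := norm_sum_smul_e_le (F.erase 0)
      (fun k => ⟪e k, Y 0 + h • polyNonlin q a (Y 0)⟫ + g 0 k) (ε := ε) fun k hk => by
        have := hg0 k (Finset.mem_of_mem_erase hk)
        rw [if_neg (Finset.mem_erase.1 hk).1] at this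
        convert this using 2
        ring
    calc C * _ ≤ C * ((F.erase 0).card * ε) := mul_le_mul_of_nonneg_left h2 hC
      _ ≤ C * (2 * F.card * ε) := by
        refine mul_le_mul_of_nonneg_left ?_ hC
        nlinarith
      _ = ε * (C * (2 * F.card)) := by ring
      _ ≤ _ := mul_le_mul_of_nonneg_left (hCR.trans hge) hε

/-! ### Fourier modes of the Wiener increments -/

section Increments

variable {η : ℝ} [Fact (0 < η)] {ν : ℝ}

/-- The Riesz representative in `H_r` of the `k`-th coefficient functional is a multiple of `e_k`. -/
theorem inner_smul_basisVec {r : ℝ} (k : ℤ) (u : InterpSpace η r) :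
    ⟪(weight η k ^ (2 * r))⁻¹ • InterpSpace.basisVec η r k, u⟫ = u.coeff k := by
  have hw := (Real.rpow_pos_of_pos (weight_pos η k) (2 * r)).ne'
  rw [InterpSpace.inner_eq_tsum, tsum_eq_single k]
  · rw [InterpSpace.coeff_smul, InterpSpace.coeff_basisVec, if_pos rfl]
    field_simp
  · intro n hn
    rw [InterpSpace.coeff_smul, InterpSpace.coeff_basisVec, if_neg hn]
    simp

variable {Ω : Type*} [MeasurableSpace Ω] {P : Measure Ω} {T : ℝ}
  {W : ℝ → Ω → InterpSpace η (-ν)} {hν0 : -ν ≤ 0}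

theorem measurable_coeff_increment
    (hW : IsCylindricalWiener (InterpSpace.ofL2 η hν0) T W P) {s t : ℝ} (hs : s ∈ Icc 0 T)
    (ht : t ∈ Icc 0 T) (k : ℤ) : Measurable fun ω => (W t ω - W s ω).coeff k := by
  have h : ∀ ω, (W t ω - W s ω).coeff k =
      InterpSpace.coeffCLM η (-ν) k (W t ω) - InterpSpace.coeffCLM η (-ν) k (W s ω) :=
    fun ω => map_sub (InterpSpace.coeffCLM η (-ν) k) _ _
  simp_rw [h]
  exact ((InterpSpace.coeffCLM η (-ν) k).continuous.measurable.comp (hW.measurable t ht)).sub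
    ((InterpSpace.coeffCLM η (-ν) k).continuous.measurable.comp (hW.measurable s hs))

theorem map_sum_coeff_increment
    (hW : IsCylindricalWiener (InterpSpace.ofL2 η hν0) T W P) {s t : ℝ} (hs : 0 ≤ s) (hst : s ≤ t)
    (ht : t ≤ T) (F : Finset ℤ) (c : F → ℝ) :
    P.map (fun ω => ∑ k, c k * (W t ω - W s ω).coeff k) =
      gaussianReal 0 ((t - s).toNNReal * (∑ k, c k ^ 2).toNNReal) := by
  set x : InterpSpace η (-ν) :=
    ∑ k, c k • ((weight η k ^ (2 * -ν))⁻¹ • InterpSpace.basisVec η (-ν) k) with hx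
  have hinner : ∀ u : InterpSpace η (-ν), ⟪x, u⟫ = ∑ k, c k * u.coeff k := by
    intro u
    rw [hx, sum_inner]
    refine Finset.sum_congr rfl fun k _ => ?_
    rw [real_inner_smul_left, inner_smul_basisVec]
  have hadj : ContinuousLinearMap.adjoint (InterpSpace.ofL2 η hν0) x = ∑ k, c k • e (k : ℤ) := by
    refine ext_inner_right ℝ fun v => ?_
    rw [ContinuousLinearMap.adjoint_inner_left, hinner, sum_inner]
    refine Finset.sum_congr rfl fun k _ => ?_
    rw [real_inner_smul_left, InterpSpace.coeff_ofL2]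
  have hnorm : ‖ContinuousLinearMap.adjoint (InterpSpace.ofL2 η hν0) x‖ ^ 2 = ∑ k, c k ^ 2 := by
    have h := (orthonormal_e.comp _ Subtype.val_injective).inner_sum (ι := F) c c Finset.univ
    simp only [Function.comp_apply] at h
    rw [hadj, ← real_inner_self_eq_norm_sq, h]
    refine Finset.sum_congr rfl fun k _ => ?_
    simp [pow_two]
  have hlaw := (hW.gaussian s t hs hst ht x).map_eq
  simp_rw [hinner] at hlaw
  rw [hlaw, hnorm, Real.toNNReal_mul (sub_nonneg.2 hst)]

theorem measure_coeff_increment_mem [IsProbabilityMeasure P]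
    (hW : IsCylindricalWiener (InterpSpace.ofL2 η hν0) T W P) {s t : ℝ} (hs : 0 ≤ s) (hst : s ≤ t)
    (ht : t ≤ T) (F : Finset ℤ) {B : ℤ → Set ℝ} (hB : ∀ k, MeasurableSet (B k)) :
    P {ω | ∀ k ∈ F, (W t ω - W s ω).coeff k ∈ B k} =
      ∏ k ∈ F, gaussianReal 0 (t - s).toNNReal (B k) := by
  have hm : ∀ k : F, Measurable fun ω => (W t ω - W s ω).coeff k := fun k =>
    measurable_coeff_increment hW ⟨hs, hst.trans ht⟩ ⟨hs.trans hst, ht⟩ k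
  have hind := iIndepFun_of_linearCombination_gaussian (fun k => (hm k).aemeasurable)
    (map_sum_coeff_increment hW hs hst ht F)
  have hmarg : ∀ k : F, P.map (fun ω => (W t ω - W s ω).coeff k) =
      gaussianReal 0 (t - s).toNNReal := by
    classical
    intro k
    have := map_sum_coeff_increment hW hs hst ht F (Pi.single k 1)
    simpa [Pi.single_apply, ite_pow] using this
  have hset : {ω | ∀ k ∈ F, (W t ω - W s ω).coeff k ∈ B k} =
      ⋂ k : F, (fun ω => (W t ω - W s ω).coeff k) ⁻¹' B k := by
    ext ω; simp
  rw [hset, hind.meas_iInter fun k => ⟨B k, hB k, rfl⟩, ← Finset.prod_coe_sort F]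
  refine Finset.prod_congr rfl fun k _ => ?_
  rw [← hmarg k, Measure.map_apply (hm k) (hB k)]

/-- The Fourier modes of the increments over the uniform grid with `N` steps are independent and
have the law `N(0, T / N)`. -/
theorem measure_grid_coeff_mem [IsProbabilityMeasure P] (hT : 0 < T)
    (hW : IsCylindricalWiener (InterpSpace.ofL2 η hν0) T W P) {N : ℕ} (hN : 1 ≤ N)
    (F : Finset ℤ) {B : ℕ → ℤ → Set ℝ} (hB : ∀ n k, MeasurableSet (B n k)) :
    MeasurableSet {ω | ∀ n < N, ∀ k ∈ F,
      (W ((n + 1) * T / N) ω - W (n * T / N) ω).coeff k ∈ B n k} ∧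
    P {ω | ∀ n < N, ∀ k ∈ F, (W ((n + 1) * T / N) ω - W (n * T / N) ω).coeff k ∈ B n k} =
      ∏ n ∈ Finset.range N, ∏ k ∈ F, gaussianReal 0 (T / N).toNNReal (B n k) := by
  have hN0 : (0 : ℝ) < N := by exact_mod_cast hN
  have hgrid : ∀ n : ℕ, n ≤ N → (n : ℝ) * T / N ∈ Icc 0 T := by
    intro n hn
    refine ⟨by positivity, ?_⟩
    rw [div_le_iff₀ hN0, mul_comm]
    exact mul_le_mul_of_nonneg_left (by exact_mod_cast hn) hT.le
  have hgrid' : ∀ n : ℕ, n < N → ((n : ℝ) + 1) * T / N ∈ Icc 0 T := by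
    intro n hn
    have := hgrid (n + 1) hn
    push_cast at this
    exact this
  have hle : ∀ n : ℕ, (n : ℝ) * T / N ≤ ((n : ℝ) + 1) * T / N := by
    intro n
    gcongr
    linarith
  have hset : {ω | ∀ n < N, ∀ k ∈ F,
      (W ((n + 1) * T / N) ω - W (n * T / N) ω).coeff k ∈ B n k} =
      ⋂ i : Fin N, {ω | ∀ k ∈ F,
        (W (((i : ℕ) + 1) * T / N) ω - W ((i : ℕ) * T / N) ω).coeff k ∈ B i k} := by
    ext ω
    simp only [Set.mem_ofPred_eq, mem_iInter]
    exact ⟨fun h i => h i i.2, fun h n hn => h ⟨n, hn⟩⟩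
  rw [hset]
  constructor
  · refine MeasurableSet.iInter fun i => ?_
    have : {ω | ∀ k ∈ F,
        (W (((i : ℕ) + 1) * T / N) ω - W ((i : ℕ) * T / N) ω).coeff k ∈ B i k} =
        ⋂ k ∈ F, (fun ω => (W (((i : ℕ) + 1) * T / N) ω - W ((i : ℕ) * T / N) ω).coeff k) ⁻¹'
          B i k := by
      ext ω; simp
    rw [this]
    exact Finset.measurableSet_biInter _ fun k _ =>
      measurable_coeff_increment hW (hgrid i i.2.le) (hgrid' i i.2) k (hB i k)
  · have hind := hW.indep N (fun i => ⟨(i : ℕ) * T / N, hgrid i (Nat.lt_succ_iff.1 i.2)⟩) (by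
      intro i j hij
      have : ((i : ℕ) : ℝ) ≤ ((j : ℕ) : ℝ) := by exact_mod_cast hij
      refine Subtype.mk_le_mk.2 ?_
      gcongr)
    have hBm : ∀ i : Fin N,
        MeasurableSet {w : InterpSpace η (-ν) | ∀ k ∈ F, w.coeff k ∈ B i k} := by
      intro i
      have : {w : InterpSpace η (-ν) | ∀ k ∈ F, w.coeff k ∈ B i k} =
          ⋂ k ∈ F, InterpSpace.coeffCLM η (-ν) k ⁻¹' B i k := by
        ext w
        simp only [Set.mem_ofPred_eq, mem_iInter]
        rfl
      rw [this]
      exact Finset.measurableSet_biInter _ fun k _ =>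
        (InterpSpace.coeffCLM η (-ν) k).continuous.measurable (hB i k)
    rw [hind.meas_iInter fun i => ⟨_, hBm i, by
      ext ω
      simp only [Fin.val_succ, Fin.val_castSucc, mem_preimage, Set.mem_ofPred_eq, Nat.cast_add,
        Nat.cast_one]⟩, ← Fin.prod_univ_eq_prod_range
          (fun n => ∏ k ∈ F, gaussianReal 0 (T / N).toNNReal (B n k))]
    refine Finset.prod_congr rfl fun i _ => ?_
    rw [measure_coeff_increment_mem hW (hgrid i i.2.le).1 (hle i) (hgrid' i i.2).2 F (hB i)]
    congr! 4
    ring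

/-- Lower bound for the probability that all modes of all increments are `ε`-close to prescribed
values of size at most `M`. -/
theorem le_measure_grid_coeff_close [IsProbabilityMeasure P] (hT : 0 < T)
    (hW : IsCylindricalWiener (InterpSpace.ofL2 η hν0) T W P) {N : ℕ} (hN : 1 ≤ N)
    (F : Finset ℤ) {m : ℕ → ℤ → ℝ} {ε M : ℝ} (hε : 0 ≤ ε) (hm : ∀ n < N, ∀ k ∈ F, |m n k| ≤ M) :
    MeasurableSet {ω | ∀ n < N, ∀ k ∈ F,
      |(W ((n + 1) * T / N) ω - W (n * T / N) ω).coeff k - m n k| ≤ ε} ∧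
    ENNReal.ofReal (2 * ε * ((√(2 * Real.pi * (T / N)))⁻¹ *
      Real.exp (-(M + ε) ^ 2 / (2 * (T / N))))) ^ (N * F.card) ≤
    P {ω | ∀ n < N, ∀ k ∈ F,
      |(W ((n + 1) * T / N) ω - W (n * T / N) ω).coeff k - m n k| ≤ ε} := by
  have hN0 : (0 : ℝ) < N := by exact_mod_cast hN
  have hh : 0 < T / N := by positivity
  have hset : {ω | ∀ n < N, ∀ k ∈ F,
      |(W ((n + 1) * T / N) ω - W (n * T / N) ω).coeff k - m n k| ≤ ε} =
      {ω | ∀ n < N, ∀ k ∈ F,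
      (W ((n + 1) * T / N) ω - W (n * T / N) ω).coeff k ∈ Icc (m n k - ε) (m n k + ε)} := by
    ext ω
    simp only [Set.mem_ofPred_eq, mem_Icc, abs_le]
    grind
  obtain ⟨h1, h2⟩ := measure_grid_coeff_mem hT hW hN F
    (B := fun n k => Icc (m n k - ε) (m n k + ε)) fun _ _ => measurableSet_Icc
  rw [hset]
  refine ⟨h1, ?_⟩
  rw [h2, pow_mul']
  calc _ = ∏ _n ∈ Finset.range N, ∏ _k ∈ F, ENNReal.ofReal (2 * ε *
        ((√(2 * Real.pi * (T / N)))⁻¹ * Real.exp (-(M + ε) ^ 2 / (2 * (T / N))))) := by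
        simp
    _ ≤ _ := by
      refine Finset.prod_le_prod' fun n hn => Finset.prod_le_prod' fun k hk => ?_
      have hv : (T / N).toNNReal ≠ 0 := by simpa using hh
      refine le_trans ?_ (le_gaussianReal_Icc hv (m n k) ε)
      rw [Real.coe_toNNReal _ hh.le]
      have hmk := hm n (Finset.mem_range.1 hn) k hk
      gcongr

end Increments

/-! ### Double exponential growth beats the probability of the event -/

theorem tendsto_two_pow_sub_pow {b : ℝ} (hb : 0 < b) (c : ℝ) (d : ℕ) :
    Tendsto (fun N : ℕ => b * 2 ^ (N - 1) - c * (N : ℝ) ^ d) atTop atTop := by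
  have h1 : Tendsto (fun N : ℕ => b / 2 - c * ((N : ℝ) ^ d / 2 ^ N)) atTop (𝓝 (b / 2)) := by
    simpa using ((tendsto_pow_const_div_const_pow_of_one_lt d
      (one_lt_two (α := ℝ))).const_mul c).const_sub (b / 2)
  refine (Tendsto.atTop_mul_pos (half_pos hb)
    (tendsto_pow_atTop_atTop_of_one_lt (one_lt_two (α := ℝ))) h1).congr' ?_
  filter_upwards [eventually_ge_atTop 1] with N hN
  obtain ⟨k, rfl⟩ := Nat.exists_eq_add_of_le' hN
  rw [Nat.add_sub_cancel]
  field_simp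
  ring

/-- The Gaussian probability of closeness `(2A)⁻ᴺ` to a value of polynomial size is bounded from
below by the exponential of a negative power of `N`. -/
theorem exp_neg_pow_le {T A M₀ : ℝ} (hT : 0 < T) (hA : 1 ≤ A) (hM₀ : 0 ≤ M₀) (q : ℕ) {N : ℕ}
    (hN : 1 ≤ N) :
    Real.exp (-((Real.log (2 * A) + √(2 * Real.pi * T) + (M₀ + 1) ^ 2 / (2 * T)) *
      (N : ℝ) ^ (2 * q + 1))) ≤
    2 * ((2 * A) ^ N)⁻¹ * ((√(2 * Real.pi * (T / N)))⁻¹ *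
      Real.exp (-(M₀ * (N : ℝ) ^ q + ((2 * A) ^ N)⁻¹) ^ 2 / (2 * (T / N)))) := by
  have hN1 : (1 : ℝ) ≤ N := by exact_mod_cast hN
  have hN0 : (0 : ℝ) < N := by linarith
  have h2A : 1 ≤ 2 * A := by linarith
  have hlog : 0 ≤ Real.log (2 * A) := Real.log_nonneg h2A
  have hpow : (N : ℝ) ≤ (N : ℝ) ^ (2 * q + 1) := le_self_pow₀ hN1 (by omega)
  have hε1 : ((2 * A) ^ N)⁻¹ ≤ 1 := inv_le_one_of_one_le₀ (one_le_pow₀ h2A)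
  have hε0 : 0 ≤ ((2 * A) ^ N)⁻¹ := by positivity
  rw [add_mul, add_mul, neg_add, neg_add, Real.exp_add, Real.exp_add, mul_assoc]
  refine mul_le_mul ?_ (mul_le_mul ?_ ?_ (Real.exp_pos _).le (by positivity)) (by positivity)
    (by positivity)
  · calc Real.exp (-(Real.log (2 * A) * (N : ℝ) ^ (2 * q + 1)))
        ≤ Real.exp (-(Real.log (2 * A) * N)) := by gcongr
      _ = ((2 * A) ^ N)⁻¹ := by
        rw [Real.exp_neg, mul_comm, Real.exp_nat_mul, Real.exp_log (by linarith)]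
      _ ≤ _ := by linarith
  · rw [Real.exp_neg]
    have hs : 0 < √(2 * Real.pi * (T / N)) := by positivity
    gcongr
    calc √(2 * Real.pi * (T / N)) ≤ √(2 * Real.pi * T) := by
          gcongr
          exact div_le_self hT.le hN1
      _ ≤ √(2 * Real.pi * T) * (N : ℝ) ^ (2 * q + 1) :=
          le_mul_of_one_le_right (by positivity) (one_le_pow₀ hN1)
      _ ≤ _ := by linarith [Real.add_one_le_exp (√(2 * Real.pi * T) * (N : ℝ) ^ (2 * q + 1))]
  · refine Real.exp_le_exp.2 ?_
    rw [neg_div, neg_le_neg_iff]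
    have h1 : M₀ * (N : ℝ) ^ q + ((2 * A) ^ N)⁻¹ ≤ (M₀ + 1) * (N : ℝ) ^ q := by
      have := one_le_pow₀ hN1 (n := q)
      linarith
    calc (M₀ * (N : ℝ) ^ q + ((2 * A) ^ N)⁻¹) ^ 2 / (2 * (T / N))
        ≤ ((M₀ + 1) * (N : ℝ) ^ q) ^ 2 / (2 * (T / N)) := by gcongr
      _ = _ := by field_simp; ring

/-- The first step of the scheme starts from a state of polynomial size. -/
theorem norm_drift_le {q : ℕ} (a : ℕ → ℝ) {T D : ℝ} (hT : 0 < T) {N : ℕ} (hN : 1 ≤ N)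
    {v : H} (hv : fourierTrunc (Finset.Icc (-(N : ℤ)) N) v = v) (hvD : ‖v‖ ≤ D) :
    ‖v + (T / N) • polyNonlin q a v‖ ≤
      (D + T * ∑ k ∈ Finset.range (q + 1), |a k| * (6 * D) ^ k) * (N : ℝ) ^ q := by
  have hN1 : (1 : ℝ) ≤ N := by exact_mod_cast hN
  have hD : 0 ≤ D := (norm_nonneg _).trans hvD
  have hcard : ((Finset.Icc (-(N : ℤ)) N).card : ℝ) ≤ 3 * N := by
    rw [Int.card_Icc]
    have : ((N : ℤ) + 1 - -N).toNat = 2 * N + 1 := by omega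
    rw [this]
    push_cast
    linarith
  have h1 : ‖polyNonlin q a v‖ ≤
      (∑ k ∈ Finset.range (q + 1), |a k| * (6 * D) ^ k) * (N : ℝ) ^ q := by
    refine (norm_polyNonlin_le a hv).trans ?_
    rw [Finset.sum_mul]
    refine Finset.sum_le_sum fun k hk => ?_
    rw [mul_assoc |a k|]
    refine mul_le_mul_of_nonneg_left ?_ (abs_nonneg _)
    calc (2 * ((Finset.Icc (-(N : ℤ)) N).card : ℝ) * ‖v‖) ^ k ≤ (2 * (3 * N) * D) ^ k := by gcongr
      _ = (6 * D) ^ k * (N : ℝ) ^ k := by rw [← mul_pow]; ring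
      _ ≤ _ := by
        have hkq : k ≤ q := Nat.lt_succ_iff.1 (Finset.mem_range.1 hk)
        gcongr
  have h2 : T / N ≤ T := div_le_self hT.le hN1
  refine (norm_add_le _ _).trans ?_
  rw [norm_smul, Real.norm_of_nonneg (by positivity), add_mul, mul_assoc T]
  have h3 := one_le_pow₀ hN1 (n := q)
  exact add_le_add (hvD.trans (le_mul_of_one_le_right hD h3))
    (mul_le_mul h2 h1 (norm_nonneg _) hT.le)

/-- The moment bound for a fixed number `N` of time steps: the `N`-th state is doubly exponentially
large on an event whose probability is not smaller than the exponential of a power of `N`. -/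
theorem exp_le_lintegral_enorm_rpow {η : ℝ} [Fact (0 < η)] {ν : ℝ} {hν0 : -ν ≤ 0} {Ω : Type*}
    [MeasurableSpace Ω] {P : Measure Ω} [IsProbabilityMeasure P] {T : ℝ} (hT : 0 < T)
    {W : ℝ → Ω → InterpSpace η (-ν)}
    (hW : IsCylindricalWiener (InterpSpace.ofL2 η hν0) T W P)
    {q : ℕ} (hq : 2 ≤ q) {a : ℕ → ℝ} {α K C A κ M₁ p : ℝ} (hp : 0 < p) (hα : 0 < α) (hK0 : 0 ≤ K)
    (hC0 : 0 ≤ C) (hA : 1 + C * (1 + 2 * K / α) ≤ A) (hκ1 : 1 ≤ κ) (h8 : 8 ≤ T * α * κ)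
    (hCκ : 6 * C ≤ κ) (hM₁0 : 0 ≤ M₁)
    (hcoer : ∀ u, κ ≤ |u| → α * |u| ^ q ≤ |coeffPoly q a u|)
    (hK : ∀ u v : ℝ, 1 ≤ |u| → |v| ≤ |u| →
      |coeffPoly q a (u + v) - coeffPoly q a u| ≤ K * |u| ^ (q - 1) * |v|)
    {N : ℕ} (hN : 1 ≤ N) (h1 : 6 * ((N : ℝ) ^ 1 / 2 ^ N) ≤ 1)
    (h2 : K * ((N : ℝ) ^ 0 / 2 ^ N) ≤ α / 4) (h3 : T * α / 2 ≤ N)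
    {L : H →ₗ[ℝ] H} (hL0 : L (e 0) = e 0) (hLm : ∀ w, ⟪e 0, L w⟫ = ⟪e 0, w⟫)
    (hLC : ∀ w, ‖L w‖ ≤ C * ‖w‖) {Y : ℕ → Ω → H} {y₀ : H} (hY0 : ∀ ω, Y 0 ω = y₀)
    (hYF : ∀ n ≤ N, ∀ ω, fourierTrunc (Finset.Icc (-(N : ℤ)) N) (Y n ω) = Y n ω)
    (hdrift : ‖y₀ + (T / N) • polyNonlin q a y₀‖ ≤ M₁ * (N : ℝ) ^ q)
    (hstep : ∀ n < N, ∀ ω, Y (n + 1) ω = L (∑ k ∈ Finset.Icc (-(N : ℤ)) N,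
      (⟪e k, Y n ω + (T / N) • polyNonlin q a (Y n ω)⟫ +
        (W ((n + 1) * T / N) ω - W (n * T / N) ω).coeff k) • e k)) :
    ENNReal.ofReal (Real.exp (p * Real.log 2 * 2 ^ (N - 1) -
      3 * (Real.log (2 * A) + √(2 * Real.pi * T) + (κ + 1 + M₁ + 1) ^ 2 / (2 * T)) *
        (N : ℝ) ^ (2 * q + 3))) ≤ ∫⁻ ω, ‖Y N ω‖ₑ ^ p ∂P := by
  have hA1 : 1 ≤ A := by
    have : 0 ≤ C * (1 + 2 * K / α) := by positivity
    linarith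
  set M₀ := κ + 1 + M₁ with hM₀_def
  have hM₀0 : 0 ≤ M₀ := by linarith
  set c := Real.log (2 * A) + √(2 * Real.pi * T) + (M₀ + 1) ^ 2 / (2 * T) with hc_def
  have hc0 : 0 ≤ c := by
    have := Real.log_nonneg (by linarith : 1 ≤ 2 * A)
    positivity
  have hN1 : (1 : ℝ) ≤ N := by exact_mod_cast hN
  have hN0 : (0 : ℝ) < N := by linarith
  set F := Finset.Icc (-(N : ℤ)) N with hF_def
  have h0F : (0 : ℤ) ∈ F := by simp [hF_def]
  have hcard : F.card = 2 * N + 1 := by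
    rw [hF_def, Int.card_Icc]
    omega
  have hcard' : (F.card : ℝ) ≤ 3 * N := by
    rw [hcard]
    push_cast
    linarith
  -- the prescribed modes of the increments: the first one cancels the state `y₀ + h p(y₀)` and
  -- puts the constant `κ N + 1` in its place
  set m : ℕ → ℤ → ℝ := fun n k => if n = 0 then
    (if k = 0 then κ * N + 1 else 0) - ⟪e k, y₀ + (T / N) • polyNonlin q a y₀⟫ else 0 with hm_def
  have hNq : (N : ℝ) ≤ (N : ℝ) ^ q := le_self_pow₀ hN1 (by omega)
  have hm : ∀ n < N, ∀ k ∈ F, |m n k| ≤ M₀ * (N : ℝ) ^ q := by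
    intro n _ k _
    simp only [hm_def]
    split_ifs
    · refine (abs_sub _ _).trans ?_
      have := (abs_inner_e_le k _).trans hdrift
      rw [abs_of_nonneg (by positivity : 0 ≤ κ * N + 1)]
      nlinarith
    · refine (abs_sub _ _).trans ?_
      have := (abs_inner_e_le k _).trans hdrift
      rw [abs_zero]
      nlinarith
    · rw [abs_zero]; positivity
  -- small enough to keep the relative fluctuation `ε Aⁿ ≤ 2⁻ᴺ` negligible for all `n ≤ N`
  set ε := ((2 * A) ^ N)⁻¹ with hε_def
  have hε0 : 0 ≤ ε := by positivity
  have hε1 : ε ≤ 1 := inv_le_one_of_one_le₀ (one_le_pow₀ (by linarith))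
  have hεA : ε * A ^ N = 1 / 2 ^ N := by
    rw [hε_def, mul_pow]
    field_simp
  obtain ⟨hGm, hGP⟩ := le_measure_grid_coeff_close hT hW hN F hε0 hm
  set G := {ω | ∀ n < N, ∀ k ∈ F,
    |(W ((n + 1) * T / N) ω - W (n * T / N) ω).coeff k - m n k| ≤ ε} with hG_def
  have hexplode : ∀ ω ∈ G, (2 : ℝ) ^ 2 ^ (N - 1) ≤ ‖Y N ω‖ := by
    intro ω hω
    have hκN : 1 ≤ κ * N := by nlinarith
    have hTN : 0 < T / N := by positivity
    have key := scheme_doubly_exponential hq hα hK0 hC0 hTN hε0 hε1 h0F hA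
      (R := κ * N) (N := N) hκN ?_ ?_ ?_ ?_ ?_ hK hL0 hLm hLC (Y := fun n => Y n ω)
      (g := fun n k => (W ((n + 1) * T / N) ω - W (n * T / N) ω).coeff k)
      (fun n hn => hYF n hn ω) ?_ ?_ ?_ hN
    · refine key.trans ?_
      have : T / N * α / 2 ≤ 1 := by
        rw [div_mul_eq_mul_div, div_div, div_le_one (by positivity)]
        linarith
      exact mul_le_of_le_one_left (norm_nonneg _) this
    · have e1 : T / N * α * (κ * N) = T * α * κ := by field_simp
      rw [e1]
      exact h8
    · calc C * (2 * F.card) ≤ C * (2 * (3 * N)) := by gcongr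
        _ = 6 * C * N := by ring
        _ ≤ _ := by gcongr
    · rw [hεA]
      calc 2 * (F.card : ℝ) * (1 / 2 ^ N) ≤ 2 * (3 * N) * (1 / 2 ^ N) := by gcongr
        _ = 6 * ((N : ℝ) ^ 1 / 2 ^ N) := by ring
        _ ≤ 1 := h1
    · rw [hεA, ← pow_zero (N : ℝ)]
      exact h2
    · exact fun u hu => hcoer u ((le_mul_of_one_le_right (by linarith) hN1).trans hu)
    · exact fun n hn => hstep n hn ω
    · intro k hk
      have := hω 0 (by omega) k hk
      simp only [hm_def, if_true] at this
      simp only [hY0]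
      exact this
    · intro n hn hnN k hk
      have := hω n hnN k hk
      simp only [hm_def, if_neg (by omega : n ≠ 0), sub_zero] at this
      exact this
  have hprob : ENNReal.ofReal (Real.exp (-(3 * c * (N : ℝ) ^ (2 * q + 3)))) ≤ P G := by
    refine le_trans ?_ hGP
    refine le_trans ?_ (pow_le_pow_left₀ zero_le
      (ENNReal.ofReal_le_ofReal (exp_neg_pow_le hT hA1 (by positivity) q hN)) _)
    rw [← ENNReal.ofReal_pow (Real.exp_pos _).le, ← Real.exp_nat_mul]
    refine ENNReal.ofReal_le_ofReal (Real.exp_le_exp.2 ?_)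
    rw [mul_neg, neg_le_neg_iff]
    push_cast
    calc (N : ℝ) * F.card * (c * (N : ℝ) ^ (2 * q + 1))
        ≤ (N : ℝ) * (3 * N) * (c * (N : ℝ) ^ (2 * q + 1)) := by gcongr
      _ = _ := by ring
  calc ENNReal.ofReal (Real.exp (p * Real.log 2 * 2 ^ (N - 1) - 3 * c * (N : ℝ) ^ (2 * q + 3)))
      = ENNReal.ofReal ((2 : ℝ) ^ 2 ^ (N - 1)) ^ p *
        ENNReal.ofReal (Real.exp (-(3 * c * (N : ℝ) ^ (2 * q + 3)))) := by
        rw [ENNReal.ofReal_rpow_of_pos (by positivity), ← ENNReal.ofReal_mul (by positivity),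
          sub_eq_add_neg, Real.exp_add]
        congr 2
        rw [← Real.rpow_natCast 2 (2 ^ (N - 1)), ← Real.rpow_mul zero_le_two, Real.rpow_def_of_pos two_pos]
        congr 1
        push_cast
        ring
    _ ≤ ENNReal.ofReal ((2 : ℝ) ^ 2 ^ (N - 1)) ^ p * P G := by gcongr
    _ = ∫⁻ _ in G, ENNReal.ofReal ((2 : ℝ) ^ 2 ^ (N - 1)) ^ p ∂P := by rw [setLIntegral_const]
    _ ≤ ∫⁻ ω in G, ‖Y N ω‖ₑ ^ p ∂P := by
        refine setLIntegral_mono' hGm fun ω hω => ENNReal.rpow_le_rpow ?_ hp.le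
        rw [← ofReal_norm]
        exact ENNReal.ofReal_le_ofReal (hexplode ω hω)
    _ ≤ _ := setLIntegral_le_lintegral _ _

/-- The operator `S_N`, restricted to `H`, fixes constants, preserves the mean and is bounded
uniformly in `N`. The smoothing hypothesis, with `r = -ν`, is what makes the restriction map into
`H`, and `s = 0` in the bound gives the uniform operator norm. -/
theorem exists_smoothing_restrict {η : ℝ} [Fact (0 < η)] {ν : ℝ} (hν0 : -ν ≤ 0) (hν1 : ν ≤ 1)
    (B : InterpSpace η (-ν) →L[ℝ] InterpSpace η (-ν)) {C : ℝ}
    (hsmooth : ∀ u : InterpSpace η (-ν), ∃ z : InterpSpace η (-ν + 1),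
      InterpSpace.incl (le_add_of_le_of_nonneg le_rfl zero_le_one) z = B u)
    (hbound : ∀ w : H, ‖w‖ ≤ 1 → ∀ z : InterpSpace η 0,
      InterpSpace.incl hν0 z = B (InterpSpace.ofL2 η hν0 w) → ‖z‖ ≤ C)
    (hfix : B (InterpSpace.ofL2 η hν0 (e 0)) = InterpSpace.ofL2 η hν0 (e 0))
    (hsymm : ∀ u v u' v' : H, InterpSpace.ofL2 η hν0 u' = B (InterpSpace.ofL2 η hν0 u) →
      InterpSpace.ofL2 η hν0 v' = B (InterpSpace.ofL2 η hν0 v) → ⟪u', v⟫ = ⟪u, v'⟫) :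
    ∃ L : H →ₗ[ℝ] H,
      (∀ w, InterpSpace.ofL2 η hν0 (L w) = B (InterpSpace.ofL2 η hν0 w)) ∧
      L (e 0) = e 0 ∧ (∀ w, ⟪e 0, L w⟫ = ⟪e 0, w⟫) ∧ ∀ w, ‖L w‖ ≤ C * ‖w‖ := by
  obtain ⟨L, hL⟩ := exists_restrict_L2 hν0 hν1 B hsmooth
  refine ⟨L, hL, ofL2_injective hν0 ((hL _).trans hfix),
    fun w => (hsymm (e 0) w (e 0) (L w) hfix.symm (hL w)).symm, fun w => ?_⟩
  have hunit : ∀ w : H, ‖w‖ ≤ 1 → ‖L w‖ ≤ C := by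
    intro w hw
    have := hbound w hw ((InterpSpace.equivL2 η).symm (L w)) (hL w)
    rwa [LinearIsometryEquiv.norm_map] at this
  rcases eq_or_ne w 0 with rfl | hw
  · simp
  · have hw0 : 0 < ‖w‖ := norm_pos_iff.2 hw
    have := hunit (‖w‖⁻¹ • w) (by
      rw [norm_smul, norm_inv, norm_norm, inv_mul_cancel₀ hw0.ne'])
    rw [map_smul, norm_smul, norm_inv, norm_norm, inv_mul_le_iff₀ hw0] at this
    linarith

theorem theorem3p7
    {Ω : Type*} [MeasurableSpace Ω] (P : Measure Ω) [IsProbabilityMeasure P]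
    (T : ℝ) (hT : 0 < T) (η : ℝ) [Fact (0 < η)]
    (q : ℕ) (hq : 2 ≤ q) (a : ℕ → ℝ) (ha : a q ≠ 0)
    (χ : ℝ) (hχ : 1 / 4 < χ) (ν : ℝ) (hν : ν ∈ Ioo (1 / 4 : ℝ) (3 / 4))
    (ξ : InterpSpace η χ)
    (W : ℝ → Ω → InterpSpace η (-ν))
    (hW : IsCylindricalWiener (InterpSpace.ofL2 η (neg_nu_nonpos hν)) T W P)
    (S : ℕ → InterpSpace η (-ν) →L[ℝ] InterpSpace η (-ν))
    -- `S_N(H_r) ⊆ H_{r+1}` for all `r ≥ -ν`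
    (hS_smooth : ∀ N : ℕ, 1 ≤ N → ∀ (r : ℝ) (hr : -ν ≤ r) (u : InterpSpace η r),
      ∃ z : InterpSpace η (r + 1),
        InterpSpace.incl (le_add_of_le_of_nonneg hr zero_le_one) z = S N (InterpSpace.incl hr u))
    -- `sup_M sup_{s ∈ [0,1]} sup_{‖w‖_H ≤ 1} M^{-s} ‖S_M w‖_{H_s} < ∞`
    (hS_bound : ∃ C : ℝ, ∀ M : ℕ, 1 ≤ M → ∀ (s : ℝ) (hs : s ∈ Icc (0 : ℝ) 1) (w : H), ‖w‖ ≤ 1 →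
      ∀ z : InterpSpace η s,
        InterpSpace.incl ((neg_nu_nonpos hν).trans hs.1) z = S M (InterpSpace.ofL2 η (neg_nu_nonpos hν) w) →
        (M : ℝ) ^ (-s) * ‖z‖ ≤ C)
    -- `S_N e_0 = e_0`
    (hS_fix : ∀ N : ℕ, 1 ≤ N → S N (InterpSpace.ofL2 η (neg_nu_nonpos hν) (e 0)) =
      InterpSpace.ofL2 η (neg_nu_nonpos hν) (e 0))
    -- `(η - A)^{-ν} S_N v = S_N (η - A)^{-ν} v` for all `v ∈ H`
    (hS_pow : ∀ N : ℕ, 1 ≤ N → ∀ v : H,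
      InterpSpace.fracPow (-ν) (add_le_of_nonpos_right (neg_nu_nonpos hν))
          (S N (InterpSpace.ofL2 η (neg_nu_nonpos hν) v)) =
        S N (InterpSpace.fracPow (-ν) (add_le_of_nonpos_right (neg_nu_nonpos hν))
          (InterpSpace.ofL2 η (neg_nu_nonpos hν) v)))
    -- `⟨S_N u, v⟩_H = ⟨u, S_N v⟩_H` for all `u, v ∈ H`; `u'`, `v'` are `S_N u`, `S_N v` as elements of `H`
    (hS_symm : ∀ N : ℕ, 1 ≤ N → ∀ u v u' v' : H,
      InterpSpace.ofL2 η (neg_nu_nonpos hν) u' = S N (InterpSpace.ofL2 η (neg_nu_nonpos hν) u) →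
      InterpSpace.ofL2 η (neg_nu_nonpos hν) v' = S N (InterpSpace.ofL2 η (neg_nu_nonpos hν) v) →
      ⟪u', v⟫ = ⟪u, v'⟫)
    -- `P_N S_N v = S_N P_N v` for all `v ∈ H`
    (hS_proj : ∀ N : ℕ, 1 ≤ N → ∀ v : H,
      InterpSpace.galerkin η (-ν) (-ν) N (S N (InterpSpace.ofL2 η (neg_nu_nonpos hν) v)) =
        S N (InterpSpace.galerkin η (-ν) (-ν) N (InterpSpace.ofL2 η (neg_nu_nonpos hν) v)))
    (Y : ℕ → ℕ → Ω → H)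
    (hY_meas : ∀ N n : ℕ, 1 ≤ N → n ≤ N → Measurable[_, borel H] (Y N n))
    (hY_init : ∀ N : ℕ, 1 ≤ N → ∀ ω, Y N 0 ω = InterpSpace.equivL2 η (InterpSpace.galerkin η χ 0 N ξ))
    (hY_step : ∀ N n : ℕ, 1 ≤ N → n < N → ∀ ω,
      Y N (n + 1) ω = InterpSpace.equivL2 η (InterpSpace.galerkin η (-ν) 0 N (S N
        (InterpSpace.ofL2 η (neg_nu_nonpos hν) (Y N n ω + (T / N) • polyNonlin q a (Y N n ω)) +
          (W ((n + 1) * T / N) ω - W (n * T / N) ω))))) :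
    ∀ p : ℝ, 0 < p → liminf (fun N : ℕ => ∫⁻ ω, ‖Y N N ω‖ₑ ^ p ∂P) atTop = ⊤ := by
  intro p hp
  have hν0 := neg_nu_nonpos hν
  obtain ⟨C', hC'⟩ := hS_bound
  obtain ⟨C, hC0, hCC'⟩ : ∃ C, 0 ≤ C ∧ C' ≤ C := ⟨max C' 0, le_max_right _ _, le_max_left _ _⟩
  obtain ⟨K, hK0, hK⟩ := exists_abs_coeffPoly_sub_le q a
  obtain ⟨R₀, hR₀⟩ := exists_le_abs_coeffPoly (by omega : 1 ≤ q) a ha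
  have hα : 0 < |a q| / 2 := half_pos (abs_pos.2 ha)
  -- `κ N` is the level of the mean above which it grows doubly exponentially with `N` steps
  obtain ⟨κ, hκ1, hκR, h8, hCκ⟩ :
      ∃ κ, 1 ≤ κ ∧ R₀ ≤ κ ∧ 8 ≤ T * (|a q| / 2) * κ ∧ 6 * C ≤ κ := by
    have h8 : 0 < 8 / (T * (|a q| / 2)) := by positivity
    have := abs_nonneg R₀
    refine ⟨1 + |R₀| + 8 / (T * (|a q| / 2)) + 6 * C, by linarith, by linarith [le_abs_self R₀],
      ?_, by linarith⟩
    rw [← div_le_iff₀' (by positivity)]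
    linarith
  have hχ0 : 0 ≤ χ := by linarith
  have ev1 : ∀ᶠ N : ℕ in atTop, 6 * ((N : ℝ) ^ 1 / 2 ^ N) ≤ 1 :=
    (by simpa using (tendsto_pow_const_div_const_pow_of_one_lt 1
      (one_lt_two (α := ℝ))).const_mul 6 : Tendsto _ _ (𝓝 (0 : ℝ))).eventually_le_const one_pos
  have ev2 : ∀ᶠ N : ℕ in atTop, K * ((N : ℝ) ^ 0 / 2 ^ N) ≤ |a q| / 2 / 4 :=
    (by simpa using (tendsto_pow_const_div_const_pow_of_one_lt 0
      (one_lt_two (α := ℝ))).const_mul K : Tendsto _ _ (𝓝 (0 : ℝ))).eventually_le_const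
        (by positivity)
  have ev3 : ∀ᶠ N : ℕ in atTop, T * (|a q| / 2) / 2 ≤ (N : ℝ) :=
    tendsto_natCast_atTop_atTop.eventually_ge_atTop _
  suffices hlow : ∃ c : ℝ, ∀ᶠ N : ℕ in atTop, ENNReal.ofReal (Real.exp (p * Real.log 2 *
      2 ^ (N - 1) - c * (N : ℝ) ^ (2 * q + 3))) ≤ ∫⁻ ω, ‖Y N N ω‖ₑ ^ p ∂P by
    obtain ⟨c, hc⟩ := hlow
    exact Tendsto.liminf_eq (tendsto_nhds_top_mono (ENNReal.tendsto_ofReal_atTop.comp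
      (Real.tendsto_exp_atTop.comp
        (tendsto_two_pow_sub_pow (mul_pos hp (Real.log_pos one_lt_two)) c (2 * q + 3)))) hc)
  set M₁ := ‖(InterpSpace.incl hχ0 ξ : InterpSpace η 0)‖ + T * ∑ k ∈ Finset.range (q + 1),
    |a k| * (6 * ‖(InterpSpace.incl hχ0 ξ : InterpSpace η 0)‖) ^ k with hM₁
  refine ⟨3 * (Real.log (2 * (1 + C * (1 + 2 * K / (|a q| / 2)))) + √(2 * Real.pi * T) +
    (κ + 1 + M₁ + 1) ^ 2 / (2 * T)), ?_⟩
  filter_upwards [ev1, ev2, ev3, eventually_ge_atTop 1] with N h1 h2 h3 hN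
  obtain ⟨L, hLS, hL0, hLm, hLC⟩ := exists_smoothing_restrict hν0 (by linarith [hν.2]) (S N)
    (C := C) (fun u => by
      obtain ⟨z, hz⟩ := hS_smooth N hN (-ν) le_rfl u
      refine ⟨z, hz.trans (congrArg (S N) ?_)⟩
      ext n
      rw [InterpSpace.coeff_incl])
    (fun w hw z hz => by
      have := hC' N hN 0 ⟨le_rfl, zero_le_one⟩ w hw z hz
      rw [neg_zero, Real.rpow_zero, one_mul] at this
      exact this.trans hCC')
    (hS_fix N hN) (hS_symm N hN)
  refine exp_le_lintegral_enorm_rpow (a := a) hT hW hq hp hα hK0 hC0 le_rfl hκ1 h8 hCκ ?_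
    (fun u hu => hR₀ u (hκR.trans hu)) hK hN h1 h2 h3 hL0 hLm hLC (hY_init N hN) ?_
    (norm_drift_le a hT hN (fourierTrunc_equivL2_galerkin _ _)
      (norm_equivL2_galerkin_le hχ0 N ξ)) ?_
  · have : 0 ≤ ∑ k ∈ Finset.range (q + 1),
        |a k| * (6 * ‖(InterpSpace.incl hχ0 ξ : InterpSpace η 0)‖) ^ k :=
      Finset.sum_nonneg fun k _ => by positivity
    positivity
  · intro n hn ω
    rcases n with _ | n
    · rw [hY_init N hN]
      exact fourierTrunc_equivL2_galerkin _ _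
    · rw [hY_step N n hN (by omega)]
      exact fourierTrunc_equivL2_galerkin _ _
  · intro n hn ω
    rw [hY_step N n hN hn ω, galerkin_comp_eq hν0 N (S N) hLS (hS_proj N hN)]
    simp_rw [InterpSpace.coeff_add, InterpSpace.coeff_ofL2]
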